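/- Let $n\ge 2$, and let $\langle\cdot,\cdot\rangle$ be the standard inner product on $\mathbb{R}^n$. A pseudo-cone in $\mathbb{R}^n$ is a nonempty convex set $K$ with $o\notin K$ (where $o$ is the origin) such that $\lambda x\in K$ for all $x\in K$ and $\lambda\ge 1$. Let $\mathcal{PC}^n$ be the family of all sets $K\subset\mathbb{R}^n$ such that $K$ is a closed pseudo-cone, or $K=\emptyset$, or $K=\mathbb{R}^n$. Ordered by inclusion, $\mathcal{PC}^n$ is a lattice with $K\wedge L=K\cap L$, and with $K\vee L=\operatorname{cl}\operatorname{conv}(K\cup L)$ if $o\notin\operatorname{cl}\operatorname{conv}(K\cup L)$ and $K\vee L=\mathbb{R}^n$ otherwise. For $K\in\mathcal{PC}^n$ put $K^*=\{x\in\mathbb{R}^n:\langle x,y\rangle\le -1\text{ for all }y\in K\}$; in particular $\emptyset^*=\mathbb{R}^n$ and $(\mathbb{R}^n)^*=\emptyset$. Then a map $\tau\colon\mathcal{PC}^n\to\mathcal{PC}^n$ satisfies $$\tau(K\wedge L)=\tau(K)\vee\tau(L)\quad\text{and}\quad\tau(K\vee L)=\tau(K)\wedge\tau(L)\qquad\text{for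 all }K,L\in\mathcal{PC}^n$$ if and only if either $\tau$ is constant, or there is $g\in\mathrm{GL}(n)$ such that $\tau(K)=g(K^*)$ for all $K\in\mathcal{PC}^n$. -/

import Mathlib

/-- A convex pseudo-cone in `ℝⁿ`: a nonempty convex set that does not contain the origin and is
closed under multiplication by every real `c ≥ 1`. -/
structure IsPseudoCone {n : ℕ} (K : Set (EuclideanSpace ℝ (Fin n))) : Prop where
  nonempty : K.Nonempty
  convex : Convex ℝ K
  zero_notMem : (0 : EuclideanSpace ℝ (Fin n)) ∉ K
  smul_mem : ∀ x ∈ K, ∀ c : ℝ, 1 ≤ c → c • x ∈ K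

/-- The dual `K* = {x : ⟨x, y⟩ ≤ -1 for all y ∈ K}`. -/
def dualSet {n : ℕ} (K : Set (EuclideanSpace ℝ (Fin n))) : Set (EuclideanSpace ℝ (Fin n)) :=
  {x | ∀ y ∈ K, inner ℝ x y ≤ -1}

/-- The formula agrees with the convention `∅* = ℝⁿ`. -/
theorem dualSet_empty {n : ℕ} : dualSet (∅ : Set (EuclideanSpace ℝ (Fin n))) = Set.univ := by
  ext x
  simp [dualSet]

/-- The formula agrees with the convention `(ℝⁿ)* = ∅`. -/
theorem dualSet_univ {n : ℕ} : dualSet (Set.univ : Set (EuclideanSpace ℝ (Fin n))) = ∅ := by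
  refine Set.eq_empty_of_forall_notMem fun x h => ?_
  have h0 := h 0 (Set.mem_univ _)
  rw [inner_zero_right] at h0
  linarith

/-- `PC n` is the family of all `K ⊆ ℝⁿ` such that `K` is a closed pseudo-cone, or `K = ∅`, or
`K = ℝⁿ`. -/
@[ext]
structure PC (n : ℕ) where
  carrier : Set (EuclideanSpace ℝ (Fin n))
  mem_PC : (IsClosed carrier ∧ IsPseudoCone carrier) ∨ carrier = ∅ ∨ carrier = Set.univ

namespace PC

theorem isClosed {n : ℕ} (K : PC n) : IsClosed K.carrier := by
  rcases K.mem_PC with h | h | h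
  · exact h.1
  · rw [h]; exact isClosed_empty
  · rw [h]; exact isClosed_univ

theorem convex {n : ℕ} (K : PC n) : Convex ℝ K.carrier := by
  rcases K.mem_PC with h | h | h
  · exact h.2.convex
  · rw [h]; exact convex_empty
  · rw [h]; exact convex_univ

theorem smul_mem {n : ℕ} (K : PC n) (x : EuclideanSpace ℝ (Fin n)) (hx : x ∈ K.carrier)
    (c : ℝ) (hc : 1 ≤ c) : c • x ∈ K.carrier := by
  rcases K.mem_PC with h | h | h
  · exact h.2.smul_mem x hx c hc
  · rw [h] at hx; exact hx.elim
  · rw [h]; exact Set.mem_univ _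

theorem eq_univ_of_zero_mem {n : ℕ} (K : PC n)
    (h0 : (0 : EuclideanSpace ℝ (Fin n)) ∈ K.carrier) : K.carrier = Set.univ := by
  rcases K.mem_PC with h | h | h
  · exact absurd h0 h.2.zero_notMem
  · rw [h] at h0; exact h0.elim
  · exact h

theorem mem_PC_of {n : ℕ} {S : Set (EuclideanSpace ℝ (Fin n))} (hcl : IsClosed S)
    (hcv : Convex ℝ S) (h0 : (0 : EuclideanSpace ℝ (Fin n)) ∉ S)
    (hs : ∀ x ∈ S, ∀ c : ℝ, 1 ≤ c → c • x ∈ S) :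
    (IsClosed S ∧ IsPseudoCone S) ∨ S = ∅ ∨ S = Set.univ := by
  rcases S.eq_empty_or_nonempty with h | h
  · exact Or.inr (Or.inl h)
  · exact Or.inl ⟨hcl, h, hcv, h0, hs⟩

/-- The meet `K ∧ L = K ∩ L`. -/
def meet {n : ℕ} (K L : PC n) : PC n where
  carrier := K.carrier ∩ L.carrier
  mem_PC := by
    by_cases h0 : (0 : EuclideanSpace ℝ (Fin n)) ∈ K.carrier ∩ L.carrier
    · right; right
      rw [K.eq_univ_of_zero_mem h0.1, L.eq_univ_of_zero_mem h0.2, Set.inter_univ]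
    · exact mem_PC_of (K.isClosed.inter L.isClosed) (K.convex.inter L.convex) h0
        fun x hx c hc => ⟨K.smul_mem x hx.1 c hc, L.smul_mem x hx.2 c hc⟩

/-- `cl [K, L]`, the closure of the convex hull of `K ∪ L`. -/
def closedHull {n : ℕ} (K L : PC n) : Set (EuclideanSpace ℝ (Fin n)) :=
  closure (convexHull ℝ (K.carrier ∪ L.carrier))

open scoped Pointwise in
theorem closedHull_smul_mem {n : ℕ} (K L : PC n) (x : EuclideanSpace ℝ (Fin n))
    (hx : x ∈ closedHull K L) (c : ℝ) (hc : 1 ≤ c) : c • x ∈ closedHull K L := by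
  refine map_mem_closure (continuous_const_smul c) hx ?_
  intro y hy
  have hsub : c • (K.carrier ∪ L.carrier) ⊆ K.carrier ∪ L.carrier := by
    rintro _ ⟨z, hz, rfl⟩
    exact hz.imp (fun h => K.smul_mem z h c hc) (fun h => L.smul_mem z h c hc)
  have h := Set.smul_mem_smul_set (a := c) hy
  rw [← convexHull_smul] at h
  exact convexHull_mono hsub h

open Classical in
/-- The join: `K ∨ L = ℝⁿ` if the origin is in `cl [K, L]`, and `K ∨ L = cl [K, L]` otherwise. -/
noncomputable def join {n : ℕ} (K L : PC n) : PC n where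
  carrier :=
    if (0 : EuclideanSpace ℝ (Fin n)) ∈ closedHull K L then Set.univ else closedHull K L
  mem_PC := by
    split_ifs with h0
    · exact Or.inr (Or.inr rfl)
    · exact mem_PC_of isClosed_closure (convex_convexHull ℝ _).closure h0
        (closedHull_smul_mem K L)

/-- `PC n` is a lattice under inclusion, with meet `PC.meet` and join `PC.join`. -/
noncomputable instance {n : ℕ} : Lattice (PC n) where
  le K L := K.carrier ⊆ L.carrier
  le_refl K := subset_rfl
  le_trans K L M := Set.Subset.trans
  le_antisymm K L h₁ h₂ := PC.ext (Set.Subset.antisymm h₁ h₂)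
  inf := meet
  inf_le_left K L := Set.inter_subset_left
  inf_le_right K L := Set.inter_subset_right
  le_inf K L M h₁ h₂ := Set.subset_inter h₁ h₂
  sup := join
  le_sup_left K L := by
    change K.carrier ⊆ (join K L).carrier
    unfold join
    split_ifs
    · exact Set.subset_univ _
    · exact Set.subset_union_left.trans ((subset_convexHull ℝ _).trans subset_closure)
  le_sup_right K L := by
    change L.carrier ⊆ (join K L).carrier
    unfold join
    split_ifs
    · exact Set.subset_univ _
    · exact Set.subset_union_right.trans ((subset_convexHull ℝ _).trans subset_closure)
  sup_le K L M h₁ h₂ := by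
    have hM : closedHull K L ⊆ M.carrier :=
      closure_minimal (convexHull_min (Set.union_subset h₁ h₂) M.convex) M.isClosed
    change (join K L).carrier ⊆ M.carrier
    unfold join
    split_ifs with h0
    · rw [M.eq_univ_of_zero_mem (hM h0)]
    · exact hM

end PC

namespace PC

open Set Module

variable {n : ℕ}

/-! Separation makes `K ↦ K*` an involution exchanging meets and joins. The task is thus to classify
the lattice endomorphisms `σ(K) = τ(K*)`: each is constant or `K ↦ g(K)` with `g` linear and
invertible. Rays and their dual half-spaces carry the argument.

If some ray has the same image as `∅`, then `σ` is constant. Otherwise a failure of injectivity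
yields a ray that can be shortened without changing its image. This spreads to all other directions,
and moving rays against half-spaces then gives points indexed by `ℝ`, each separated by a closed set
from all earlier ones, which second countability forbids (`injective_or_constant`).

Let `σ` be injective. Uncountably many disjoint slices of a set cannot all have images spanning the
same space (`exists_slice`). Hence `σ` does not lower dimension, and enough rays go to rays. Cutting
an arbitrary ray at one point by `n` half-spaces with independent normals, whose images are
half-spaces, shows that every ray goes to a ray (`rk_map_ray_le_one`); dually for half-spaces. The
resulting point maps `φ`, `ψ` preserve the relation `⟨x, u⟩ = -1`, so for negative `⟨x, u⟩` the
value `⟨φ x, ψ u⟩` depends on `⟨x, u⟩` alone. A functional equation identifies the two values and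
makes `φ` additive (`map_add_and_inner_eq`). So `φ` is linear, and half-spaces containing `K`
determine `σ K`. -/

instance : BoundedOrder (PC n) where
  top := ⟨Set.univ, Or.inr (Or.inr rfl)⟩
  le_top K := Set.subset_univ K.carrier
  bot := ⟨∅, Or.inr (Or.inl rfl)⟩
  bot_le K := Set.empty_subset K.carrier

theorem carrier_top : (⊤ : PC n).carrier = Set.univ := rfl

theorem carrier_inf (K L : PC n) : (K ⊓ L).carrier = K.carrier ∩ L.carrier := rfl

theorem eq_bot_iff_carrier {K : PC n} : K = ⊥ ↔ K.carrier = ∅ := PC.ext_iff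

theorem eq_top_iff_zero_mem {K : PC n} :
    K = ⊤ ↔ (0 : EuclideanSpace ℝ (Fin n)) ∈ K.carrier :=
  ⟨fun h => h ▸ Set.mem_univ _, fun h => PC.ext (K.eq_univ_of_zero_mem h)⟩

theorem nonempty_of_ne_bot {K : PC n} (h : K ≠ ⊥) : K.carrier.Nonempty :=
  Set.nonempty_iff_ne_empty.2 fun h' => h (eq_bot_iff_carrier.2 h')

theorem ne_bot_of_mem {K : PC n} {x : EuclideanSpace ℝ (Fin n)} (h : x ∈ K.carrier) : K ≠ ⊥ := by
  rintro rfl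
  exact h.elim

/-- A combination of two points of `K` whose weights are nonnegative and add up to at least one
lies in `K`. -/
theorem comb_mem (K : PC n) {x y : EuclideanSpace ℝ (Fin n)} (hx : x ∈ K.carrier)
    (hy : y ∈ K.carrier) {a b : ℝ} (ha : 0 ≤ a) (hb : 0 ≤ b) (hab : 1 ≤ a + b) :
    a • x + b • y ∈ K.carrier := by
  have hpos : 0 < a + b := by linarith
  have h := K.convex hx hy (div_nonneg ha hpos.le) (div_nonneg hb hpos.le)
    (by field_simp)
  have h2 := K.smul_mem _ h _ hab
  rwa [smul_add, smul_smul, smul_smul, mul_div_cancel₀ _ hpos.ne',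
    mul_div_cancel₀ _ hpos.ne'] at h2

/-! ### Duality -/

/-- The dual set as a member of `PC n`. -/
def dual (K : PC n) : PC n where
  carrier := dualSet K.carrier
  mem_PC := by
    by_cases hK : K = ⊥
    · right; right
      rw [eq_bot_iff_carrier.1 hK, dualSet_empty]
    · obtain ⟨k, hk⟩ := nonempty_of_ne_bot hK
      have hset : dualSet K.carrier =
          ⋂ y ∈ K.carrier, {x | (inner ℝ x y : ℝ) ≤ -1} := by
        ext x; simp [dualSet]
      refine mem_PC_of ?_ ?_ ?_ ?_
      · rw [hset]
        exact isClosed_biInter fun y _ => isClosed_le (by fun_prop) continuous_const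
      · intro x hx y hy a b ha hb hab z hz
        have h1 := hx z hz
        have h2 := hy z hz
        rw [inner_add_left, real_inner_smul_left, real_inner_smul_left]
        nlinarith
      · intro h
        have := h k hk
        rw [inner_zero_left] at this
        linarith
      · intro x hx c hc z hz
        have := hx z hz
        rw [real_inner_smul_left]
        nlinarith

theorem dual_bot : (⊥ : PC n).dual = ⊤ := PC.ext dualSet_empty

theorem le_dual_dual (K : PC n) : K ≤ K.dual.dual := by
  intro x hx y hy
  rw [real_inner_comm]
  exact hy x hx

/-- Points outside `K` are separated from `K` by a member of the dual. -/
theorem exists_mem_dual_of_notMem {K : PC n} {x : EuclideanSpace ℝ (Fin n)} (hx : x ∉ K.carrier) :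
    ∃ y ∈ K.dual.carrier, -1 < (inner ℝ y x : ℝ) := by
  have h0 : (0 : EuclideanSpace ℝ (Fin n)) ∉ K.carrier := fun h =>
    hx (by rw [K.eq_univ_of_zero_mem h]; exact Set.mem_univ _)
  have key : ∀ z : EuclideanSpace ℝ (Fin n), z ∉ K.carrier → ∃ (u : EuclideanSpace ℝ (Fin n))
      (c : ℝ), (∀ k ∈ K.carrier, (inner ℝ u k : ℝ) < c) ∧ c < (inner ℝ u z : ℝ) := by
    intro z hz
    obtain ⟨f, c, h1, h2⟩ := geometric_hahn_banach_closed_point K.convex K.isClosed hz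
    refine ⟨(InnerProductSpace.toDual ℝ _).symm f, c, ?_, ?_⟩
    · intro k hk
      rw [InnerProductSpace.toDual_symm_apply]
      exact h1 k hk
    · rw [InnerProductSpace.toDual_symm_apply]
      exact h2
  -- `v` separates `K` from the origin, `u` separates it from `x`. If `u` has a negative bound, a
  -- multiple of `u` works; otherwise a large multiple of `u` is added to the normalized `v`, which
  -- is harmless because `u ≤ 0` on `K`.
  obtain ⟨v, c, hv, hc⟩ := key 0 h0
  rw [inner_zero_right] at hc
  obtain ⟨u, d, hu, hd⟩ := key x hx
  have hu0 : ∀ k ∈ K.carrier, (inner ℝ u k : ℝ) ≤ 0 := by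
    intro k hk
    by_contra! hpos
    have h := hu _ (K.smul_mem k hk (1 + |d| / inner ℝ u k)
      (by have := div_nonneg (abs_nonneg d) hpos.le; linarith))
    rw [real_inner_smul_right, add_mul, div_mul_cancel₀ _ hpos.ne'] at h
    linarith [le_abs_self d]
  have hw : ∀ k ∈ K.carrier, (inner ℝ ((-c)⁻¹ • v) k : ℝ) ≤ -1 := by
    intro k hk
    rw [real_inner_smul_left, inv_mul_le_iff₀ (by linarith)]
    linarith [hv k hk]
  rcases lt_or_ge d 0 with hd0 | hd0
  · refine ⟨(-d)⁻¹ • u, ?_, ?_⟩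
    · intro k hk
      rw [real_inner_smul_left, inv_mul_le_iff₀ (by linarith)]
      linarith [hu k hk]
    · rw [real_inner_smul_left, lt_inv_mul_iff₀ (by linarith)]
      linarith
  · have hpos : 0 < (inner ℝ u x : ℝ) := by linarith
    generalize (-c)⁻¹ • v = w at hw
    refine ⟨w + (|inner ℝ w x| / inner ℝ u x) • u, ?_, ?_⟩
    · intro k hk
      rw [inner_add_left, real_inner_smul_left]
      have := mul_nonpos_of_nonneg_of_nonpos (div_nonneg (abs_nonneg (inner ℝ w x)) hpos.le)
        (hu0 k hk)
      linarith [hw k hk]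
    · rw [inner_add_left, real_inner_smul_left, div_mul_cancel₀ _ hpos.ne']
      linarith [neg_abs_le (inner ℝ w x)]

@[simp]
theorem dual_dual (K : PC n) : K.dual.dual = K := by
  refine le_antisymm ?_ (le_dual_dual K)
  intro x hx
  by_contra h
  obtain ⟨y, hy, hyx⟩ := exists_mem_dual_of_notMem h
  have := hx y hy
  rw [real_inner_comm] at this
  linarith

theorem dual_anti {K L : PC n} (h : K ≤ L) : L.dual ≤ K.dual :=
  fun _ hx y hy => hx y (h hy)

theorem dual_le_dual {K L : PC n} : K.dual ≤ L.dual ↔ L ≤ K :=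
  ⟨fun h => by simpa using dual_anti h, dual_anti⟩

theorem dual_injective : Function.Injective (dual : PC n → PC n) := fun K L h => by
  rw [← dual_dual K, h, dual_dual]

theorem dual_sup (K L : PC n) : (K ⊔ L).dual = K.dual ⊓ L.dual := by
  refine le_antisymm (le_inf (dual_anti le_sup_left) (dual_anti le_sup_right)) ?_
  rw [← dual_le_dual, dual_dual]
  exact sup_le (by rw [← dual_le_dual, dual_dual]; exact inf_le_left)
    (by rw [← dual_le_dual, dual_dual]; exact inf_le_right)

theorem dual_inf (K L : PC n) : (K ⊓ L).dual = K.dual ⊔ L.dual := by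
  apply dual_injective
  rw [dual_sup]
  simp

/-! ### Slices, half-spaces and rays -/

/-- The points of a subspace `W` at which the functional given by `u` is at most `-1`. -/
def slice (W : Submodule ℝ (EuclideanSpace ℝ (Fin n))) (u : EuclideanSpace ℝ (Fin n)) : PC n where
  carrier := {x | x ∈ W ∧ (inner ℝ x u : ℝ) ≤ -1}
  mem_PC := by
    refine mem_PC_of ?_ ?_ ?_ ?_
    · have h : IsClosed {x : EuclideanSpace ℝ (Fin n) | (inner ℝ x u : ℝ) ≤ -1} :=
        isClosed_le (by fun_prop) continuous_const
      exact (Submodule.closed_of_finiteDimensional W).inter h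
    · rintro x ⟨hxW, hx⟩ y ⟨hyW, hy⟩ a b ha hb hab
      refine ⟨W.add_mem (W.smul_mem _ hxW) (W.smul_mem _ hyW), ?_⟩
      rw [inner_add_left, real_inner_smul_left, real_inner_smul_left]
      nlinarith
    · rintro ⟨_, h⟩
      rw [inner_zero_left] at h
      linarith
    · rintro x ⟨hxW, hx⟩ c hc
      refine ⟨W.smul_mem _ hxW, ?_⟩
      rw [real_inner_smul_left]
      nlinarith

theorem mem_slice {W : Submodule ℝ (EuclideanSpace ℝ (Fin n))} {u x : EuclideanSpace ℝ (Fin n)} :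
    x ∈ (slice W u).carrier ↔ x ∈ W ∧ (inner ℝ x u : ℝ) ≤ -1 := Iff.rfl

/-- The closed half-space `{x : ⟨x, u⟩ ≤ -1}`. -/
def hs (u : EuclideanSpace ℝ (Fin n)) : PC n := slice ⊤ u

theorem mem_hs {u x : EuclideanSpace ℝ (Fin n)} :
    x ∈ (hs u).carrier ↔ (inner ℝ x u : ℝ) ≤ -1 :=
  ⟨fun h => h.2, fun h => ⟨Submodule.mem_top, h⟩⟩

/-- The ray `{c • x : c ≥ 1}` (and the whole space if `x = 0`). -/
def ray (x : EuclideanSpace ℝ (Fin n)) : PC n := (hs x).dual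

@[simp]
theorem dual_hs (u : EuclideanSpace ℝ (Fin n)) : (hs u).dual = ray u := rfl

@[simp]
theorem dual_ray (u : EuclideanSpace ℝ (Fin n)) : (ray u).dual = hs u := dual_dual _

theorem le_hs_iff {K : PC n} {u : EuclideanSpace ℝ (Fin n)} : K ≤ hs u ↔ u ∈ K.dual.carrier := by
  refine ⟨fun h y hy => ?_, fun h y hy => ?_⟩
  · rw [real_inner_comm]
    exact mem_hs.1 (h hy)
  · rw [mem_hs, real_inner_comm]
    exact h y hy

theorem ray_le_iff {K : PC n} {x : EuclideanSpace ℝ (Fin n)} : ray x ≤ K ↔ x ∈ K.carrier := by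
  rw [← dual_le_dual, dual_ray, le_hs_iff, dual_dual]

theorem self_mem_ray (x : EuclideanSpace ℝ (Fin n)) : x ∈ (ray x).carrier :=
  ray_le_iff.1 le_rfl

theorem ray_ne_bot (x : EuclideanSpace ℝ (Fin n)) : ray x ≠ ⊥ := ne_bot_of_mem (self_mem_ray x)

theorem smul_mem_ray (x : EuclideanSpace ℝ (Fin n)) {c : ℝ} (hc : 1 ≤ c) :
    c • x ∈ (ray x).carrier := (ray x).smul_mem x (self_mem_ray x) c hc

theorem mem_ray {x y : EuclideanSpace ℝ (Fin n)} (hx : x ≠ 0) :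
    y ∈ (ray x).carrier ↔ ∃ c : ℝ, 1 ≤ c ∧ y = c • x := by
  refine ⟨fun h => ?_, ?_⟩
  · have hx2 : 0 < (inner ℝ x x : ℝ) := real_inner_self_pos.2 hx
    set s : ℝ := (inner ℝ x x : ℝ) with hs_def
    set c : ℝ := (inner ℝ y x : ℝ) / s with hc_def
    have hcs : c * s = inner ℝ y x := div_mul_cancel₀ _ hx2.ne'
    set w := y - c • x with hw_def
    have hwx : (inner ℝ w x : ℝ) = 0 := by
      rw [hw_def, inner_sub_left, real_inner_smul_left, ← hs_def, hcs, sub_self]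
    have hy : y = c • x + w := by rw [hw_def]; abel
    -- The vectors `-s⁻¹ • x + r • w` all lie in `hs x`. Letting `r` grow kills the component `w`
    -- orthogonal to `x`; then `r = 0` gives `1 ≤ c`.
    have test : ∀ r : ℝ, c * (-1) + r * (inner ℝ w w : ℝ) ≤ -1 := by
      intro r
      have hu : (-s⁻¹ • x + r • w) ∈ (hs x).carrier := by
        rw [mem_hs, inner_add_left, real_inner_smul_left, real_inner_smul_left, hwx, ← hs_def]
        field_simp
        simp
      have h2 := h _ hu
      rw [hy, inner_add_left, inner_add_right, inner_add_right, real_inner_smul_left,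
        real_inner_smul_left, real_inner_smul_right, real_inner_smul_right, real_inner_smul_right,
        real_inner_smul_right, hwx, real_inner_comm w x, hwx, ← hs_def] at h2
      have : c * (-s⁻¹ * s) = c * (-1) := by field_simp
      linarith
    have hw0 : w = 0 := by
      by_contra hw0
      have hpos : 0 < (inner ℝ w w : ℝ) := real_inner_self_pos.2 hw0
      have h2 := test ((|c| + 1) / inner ℝ w w)
      rw [div_mul_cancel₀ _ hpos.ne'] at h2
      linarith [le_abs_self c]
    refine ⟨c, ?_, by rw [hy, hw0, add_zero]⟩
    have := test 0
    linarith
  · rintro ⟨c, hc, rfl⟩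
    exact smul_mem_ray x hc

theorem ray_smul_le (x : EuclideanSpace ℝ (Fin n)) {c : ℝ} (hc : 1 ≤ c) : ray (c • x) ≤ ray x :=
  ray_le_iff.2 (smul_mem_ray x hc)

/-- A half-space cuts from a ray the part that starts on its boundary. -/
theorem ray_inf_hs {x u : EuclideanSpace ℝ (Fin n)} {c : ℝ} (hc : 0 < c) (hc1 : c ≤ 1)
    (h : (inner ℝ x u : ℝ) = -c) : ray x ⊓ hs u = ray (c⁻¹ • x) := by
  have hx : x ≠ 0 := by
    rintro rfl
    rw [inner_zero_left] at h
    linarith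
  refine le_antisymm ?_ (le_inf (ray_smul_le x ((one_le_inv₀ hc).2 hc1)) (ray_le_iff.2 ?_))
  · rintro y ⟨hy, hyu⟩
    obtain ⟨d, hd, rfl⟩ := (mem_ray hx).1 hy
    rw [mem_hs, real_inner_smul_left, h] at hyu
    refine (mem_ray (smul_ne_zero (inv_pos.2 hc).ne' hx)).2 ⟨d * c, by linarith, ?_⟩
    rw [smul_smul, mul_assoc, mul_inv_cancel₀ hc.ne', mul_one]
  · rw [mem_hs, real_inner_smul_left, h]
    field_simp
    linarith

theorem ray_inf_hs_eq_bot {x u : EuclideanSpace ℝ (Fin n)} (hx : x ≠ 0)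
    (h : 0 ≤ (inner ℝ x u : ℝ)) : ray x ⊓ hs u = ⊥ := by
  rw [eq_bot_iff_carrier]
  refine Set.eq_empty_of_forall_notMem ?_
  rintro y ⟨hy, hyu⟩
  obtain ⟨d, hd, rfl⟩ := (mem_ray hx).1 hy
  rw [mem_hs, real_inner_smul_left] at hyu
  nlinarith

/-- On a linearly independent family a functional can be prescribed. -/
theorem exists_inner_eq {ι : Type*} {x : ι → EuclideanSpace ℝ (Fin n)}
    (hx : LinearIndependent ℝ x) (c : ι → ℝ) :
    ∃ u : EuclideanSpace ℝ (Fin n), ∀ i, (inner ℝ (x i) u : ℝ) = c i := by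
  obtain ⟨g, hg⟩ := LinearMap.exists_extend ((Basis.span hx).constr ℝ c)
  refine ⟨(InnerProductSpace.toDual ℝ _).symm (LinearMap.toContinuousLinearMap g), fun i => ?_⟩
  rw [real_inner_comm, InnerProductSpace.toDual_symm_apply, LinearMap.coe_toContinuousLinearMap']
  have h1 := LinearMap.congr_fun hg (Basis.span hx i)
  rw [Basis.constr_basis] at h1
  rw [← h1, LinearMap.comp_apply, Submodule.subtype_apply, Basis.span_apply]

theorem exists_inner_pair {x y : EuclideanSpace ℝ (Fin n)} (h : LinearIndependent ℝ ![x, y])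
    (a b : ℝ) : ∃ u : EuclideanSpace ℝ (Fin n), (inner ℝ x u : ℝ) = a ∧ (inner ℝ y u : ℝ) = b := by
  obtain ⟨u, hu⟩ := exists_inner_eq h ![a, b]
  exact ⟨u, hu 0, hu 1⟩

theorem exists_inner {x : EuclideanSpace ℝ (Fin n)} (h : x ≠ 0) (a : ℝ) :
    ∃ u : EuclideanSpace ℝ (Fin n), (inner ℝ x u : ℝ) = a := by
  refine ⟨(a / inner ℝ x x) • x, ?_⟩
  rw [real_inner_smul_right, div_mul_cancel₀ _ (real_inner_self_pos.2 h).ne']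

theorem ray_inf_ray {x y : EuclideanSpace ℝ (Fin n)} (h : LinearIndependent ℝ ![x, y]) :
    ray x ⊓ ray y = ⊥ := by
  obtain ⟨u, h1, h2⟩ := exists_inner_pair h (-1) 0
  rw [eq_bot_iff, ← ray_inf_hs_eq_bot (x := y) (u := u) (h.ne_zero 1) h2.ge, inf_comm]
  exact le_inf inf_le_left (inf_le_right.trans (ray_le_iff.2 (mem_hs.2 h1.le)))

theorem ray_sup_ray_neg (x : EuclideanSpace ℝ (Fin n)) : ray x ⊔ ray (-x) = ⊤ := by
  rw [eq_top_iff_zero_mem]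
  have h := (ray x ⊔ ray (-x)).comb_mem (ray_le_iff.1 le_sup_left) (ray_le_iff.1 le_sup_right)
    (a := 1) (b := 1) zero_le_one zero_le_one (by norm_num)
  simpa using h

theorem exists_pair (hn : 2 ≤ n) {x : EuclideanSpace ℝ (Fin n)} (hx : x ≠ 0) :
    ∃ y, LinearIndependent ℝ ![x, y] :=
  exists_linearIndependent_pair_of_one_lt_finrank (by rw [finrank_euclideanSpace_fin]; omega) hx

/-! ### Nonconstant endomorphisms are injective -/

/-- If the image of one ray is the image of `∅`, then the endomorphism is constant. -/
theorem constant_of_map_ray_eq (hn : 2 ≤ n) (σ : LatticeHom (PC n) (PC n))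
    {x : EuclideanSpace ℝ (Fin n)} (hx : x ≠ 0) (h : σ (ray x) = σ ⊥) (K : PC n) :
    σ K = σ ⊥ := by
  have hbot : ∀ K, σ ⊥ ≤ σ K := fun K => OrderHomClass.mono σ bot_le
  have htop : σ (ray (-x)) = σ ⊤ := by
    rw [← ray_sup_ray_neg x, map_sup, h, sup_eq_right.2 (hbot _)]
  -- Since `ray (-x)` has the image of `⊤`, meeting with it does not change the image of `ray y`,
  -- although the meet is empty.
  have key : ∀ y, LinearIndependent ℝ ![-x, y] → σ (ray y) = σ ⊥ := by
    intro y hy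
    rw [← ray_inf_ray hy, map_inf, htop, eq_comm, inf_eq_right]
    exact OrderHomClass.mono σ le_top
  obtain ⟨y, hy⟩ := exists_pair hn (neg_ne_zero.2 hx)
  have hy' : LinearIndependent ℝ ![-x, -y] := by
    rw [LinearIndependent.pair_iff] at hy ⊢
    intro s t hst
    have := hy s (-t) (by rw [← hst]; simp)
    simpa using this
  refine le_antisymm ?_ (hbot K)
  calc σ K ≤ σ ⊤ := OrderHomClass.mono σ le_top
    _ = σ ⊥ := by rw [← ray_sup_ray_neg y, map_sup, key _ hy, key _ hy', sup_idem]

/-- If the images of `ray x₀` and of `ray (t • x₀)` agree for one `t > 1`, then the image of a ray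
in another direction does not change under dilatations. -/
theorem map_ray_le_of_map_ray_eq (σ : LatticeHom (PC n) (PC n))
    {x₀ : EuclideanSpace ℝ (Fin n)} {t : ℝ} (ht : 1 < t) (h : σ (ray x₀) ≤ σ (ray (t • x₀)))
    {z : EuclideanSpace ℝ (Fin n)} (hz : LinearIndependent ℝ ![x₀, z]) {c : ℝ} (hc : 1 ≤ c) :
    σ (ray z) ≤ σ (ray (c • z)) := by
  have ht0 : 0 < t := by linarith
  have step : ∀ z, LinearIndependent ℝ ![x₀, z] → σ (ray z) ≤ σ (ray (t • z)) := by
    intro z hz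
    obtain ⟨v, hv0, hvz⟩ := exists_inner_pair hz (-t⁻¹) (-t⁻¹)
    -- Dually to cutting `ray v` by `hs x₀`, the join of `hs v` with `ray x₀` reaches out to `hs (t
    -- • v)`. But `ray x₀` has its image below that of `ray (t • x₀)`, which already lies in `hs v`.
    have hvt : σ (hs (t • v)) ≤ σ (hs v) := by
      have h1 : hs (t • v) ≤ hs v ⊔ ray x₀ := by
        rw [← dual_le_dual, dual_sup, dual_hs, dual_hs, dual_ray,
          ray_inf_hs (inv_pos.2 ht0) (inv_le_one_of_one_le₀ ht.le)
            (by rw [real_inner_comm]; exact hv0), inv_inv]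
      have h2 : σ (ray x₀) ≤ σ (hs v) := by
        refine h.trans (OrderHomClass.mono σ (ray_le_iff.2 (mem_hs.2 ?_)))
        rw [real_inner_smul_left, hv0]
        field_simp
        simp
      have h3 : σ (hs (t • v)) ≤ σ (hs v ⊔ ray x₀) := OrderHomClass.mono σ h1
      rw [map_sup, sup_eq_left.2 h2] at h3
      exact h3
    have h4 : σ (ray z) ≤ σ (hs v) := by
      refine le_trans (OrderHomClass.mono σ (ray_le_iff.2 (mem_hs.2 ?_))) hvt
      rw [real_inner_smul_right, hvz]
      field_simp
      simp
    rw [← inf_eq_left.2 h4, ← map_inf, ray_inf_hs (inv_pos.2 ht0)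
      (inv_le_one_of_one_le₀ ht.le) hvz, inv_inv]
  have hpow : ∀ k : ℕ, σ (ray z) ≤ σ (ray (t ^ k • z)) := by
    intro k
    induction k with
    | zero => simp
    | succ k ih =>
      refine ih.trans ?_
      rw [pow_succ', mul_smul]
      refine step _ ?_
      rw [LinearIndependent.pair_iff] at hz ⊢
      intro a b hab
      have := hz a (b * t ^ k) (by rw [mul_smul]; exact hab)
      refine ⟨this.1, ?_⟩
      have h5 := this.2
      have : t ^ k ≠ 0 := (pow_pos ht0 k).ne'
      simpa [this] using h5
  obtain ⟨k, hk⟩ := pow_unbounded_of_one_lt c ht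
  refine (hpow k).trans (OrderHomClass.mono σ ?_)
  have : t ^ k • z = (t ^ k / c) • c • z := by
    rw [smul_smul, div_mul_cancel₀ _ (by linarith)]
  rw [this]
  exact ray_smul_le _ ((one_le_div (by linarith)).2 hk.le)

/-- There is no family of points indexed by `ℝ` each of which can be separated by a closed set from
all points with smaller index. -/
theorem not_left_separated {X : Type*} [TopologicalSpace X] [SecondCountableTopology X]
    (p : ℝ → X) (C : ℝ → Set X) (hC : ∀ t, IsClosed (C t)) (h1 : ∀ t, p t ∉ C t)
    (h2 : ∀ s t, s < t → p s ∈ C t) : False := by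
  -- Basic neighbourhoods of `p t` missing `C t` are distinct for distinct `t`, so `ℝ` would inject
  -- into a countable basis.
  have hU : ∀ t, ∃ U ∈ TopologicalSpace.countableBasis X, p t ∈ U ∧ U ⊆ (C t)ᶜ := fun t =>
    (TopologicalSpace.isBasis_countableBasis X).exists_subset_of_mem_open (h1 t)
      (hC t).isOpen_compl
  choose U hUb hpU hUC using hU
  have hne : ∀ s t, s < t → U s ≠ U t := fun s t hst h =>
    hUC t (h ▸ hpU s) (h2 s t hst)
  have hinj : Function.Injective
      (fun t => (⟨U t, hUb t⟩ : TopologicalSpace.countableBasis X)) := by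
    intro s t hst
    have hst' : U s = U t := congrArg Subtype.val hst
    rcases lt_trichotomy s t with h | h | h
    · exact (hne s t h hst').elim
    · exact h
    · exact (hne t s h hst'.symm).elim
  have : Countable (TopologicalSpace.countableBasis X) :=
    (TopologicalSpace.countable_countableBasis X).to_subtype
  exact not_countable (α := ℝ) hinj.countable

/-- The point `y + s • x₀` pairs with `a - t • b` to `s - t`. For `s < t` a dilate of it lies in the
half-space, and dilatations do not shrink the image of its ray; for `s = t` ray and half-space are
disjoint. Points of the images outside `σ ⊥` therefore contradict `not_left_separated`. -/
theorem false_of_map_ray_le (hn : 2 ≤ n) (σ : LatticeHom (PC n) (PC n))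
    {x₀ : EuclideanSpace ℝ (Fin n)} (hx₀ : x₀ ≠ 0) {t : ℝ} (ht : 1 < t)
    (h : σ (ray x₀) ≤ σ (ray (t • x₀))) (hne : ∀ x, x ≠ 0 → σ (ray x) ≠ σ ⊥) : False := by
  obtain ⟨y, hy⟩ := exists_pair hn hx₀
  obtain ⟨a, ha0, hay⟩ := exists_inner_pair hy 1 0
  obtain ⟨b, hb0, hby⟩ := exists_inner_pair hy 0 1
  have hind : ∀ s : ℝ, LinearIndependent ℝ ![x₀, y + s • x₀] := fun s => by
    rw [LinearIndependent.pair_iff] at hy ⊢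
    intro c d hcd
    have := hy (c + d * s) d (by rw [← hcd]; module)
    refine ⟨?_, this.2⟩
    have h1 := this.1
    rw [this.2] at h1
    simpa using h1
  have hinner : ∀ s t : ℝ, (inner ℝ (y + s • x₀) (a - t • b) : ℝ) = s - t := fun s t => by
    rw [inner_add_left, inner_sub_right, inner_sub_right, real_inner_smul_left,
      real_inner_smul_left, real_inner_smul_right, real_inner_smul_right, ha0, hay, hb0, hby]
    ring
  have hp : ∀ s : ℝ, ∃ p ∈ (σ (ray (y + s • x₀))).carrier, p ∉ (σ ⊥).carrier := by
    intro s
    by_contra! hcon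
    exact hne _ ((hind s).ne_zero 1) (le_antisymm hcon (OrderHomClass.mono σ bot_le))
  choose p hp1 hp2 using hp
  refine not_left_separated p (fun t => (σ (hs (a - t • b))).carrier) (fun t => (σ _).isClosed)
    ?_ ?_
  · intro t ht
    apply hp2 t
    rw [← ray_inf_hs_eq_bot ((hind t).ne_zero 1) (hinner t t ▸ (sub_self t).ge), map_inf]
    exact ⟨hp1 t, ht⟩
  · intro s t hst
    have hpos : 0 < t - s := by linarith
    have h1 : σ (ray (y + s • x₀)) ≤ σ (ray ((max 1 (t - s)⁻¹) • (y + s • x₀))) :=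
      map_ray_le_of_map_ray_eq σ ht h (hind s) (le_max_left _ _)
    refine (h1.trans (OrderHomClass.mono σ (ray_le_iff.2 (mem_hs.2 ?_)))) (hp1 s)
    rw [real_inner_smul_left, hinner]
    have h2 : (t - s)⁻¹ * (t - s) ≤ max 1 (t - s)⁻¹ * (t - s) :=
      mul_le_mul_of_nonneg_right (le_max_right _ _) hpos.le
    rw [inv_mul_cancel₀ hpos.ne'] at h2
    linarith

/-- A nonconstant endomorphism of the lattice `PC n` is injective. -/
theorem injective_or_constant (hn : 2 ≤ n) (σ : LatticeHom (PC n) (PC n)) :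
    Function.Injective σ ∨ ∀ K, σ K = σ ⊥ := by
  by_cases hne : ∀ x, x ≠ 0 → σ (ray x) ≠ σ ⊥
  swap
  · push Not at hne
    obtain ⟨x, hx, h⟩ := hne
    exact Or.inr (constant_of_map_ray_eq hn σ hx h)
  left
  have key : ∀ K L : PC n, σ K = σ L → L ≤ K := by
    intro K L hKL
    by_contra hLK
    obtain ⟨x, hx0, hxL, hxK⟩ : ∃ x, x ≠ 0 ∧ x ∈ L.carrier ∧ x ∉ K.carrier := by
      by_contra! hcon
      by_cases h0 : (0 : EuclideanSpace ℝ (Fin n)) ∈ L.carrier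
      · have hL := eq_top_iff_zero_mem.2 h0
        obtain ⟨v, hv⟩ := @exists_ne (EuclideanSpace ℝ (Fin n))
          (nontrivial_of_finrank_pos (R := ℝ) (by rw [finrank_euclideanSpace_fin]; omega)) 0
        have hK : K = ⊤ := by
          rw [eq_top_iff, ← ray_sup_ray_neg v]
          refine sup_le (ray_le_iff.2 (hcon v hv ?_))
            (ray_le_iff.2 (hcon _ (neg_ne_zero.2 hv) ?_)) <;> rw [hL] <;> exact Set.mem_univ _
        exact hLK (hK ▸ le_top)
      · exact hLK fun x hx => hcon x (fun h => h0 (h ▸ hx)) hx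
    -- As `K` is closed and misses `x`, it meets `ray x` only beyond some `(1 + ε / 2) • x`. Since
    -- `σ K = σ L` and `x ∈ L`, meeting with `K` does not change the image of `ray x`.
    have hopen : IsOpen {s : ℝ | s • x ∉ K.carrier} :=
      K.isClosed.isOpen_compl.preimage (by fun_prop : Continuous fun s : ℝ => s • x)
    obtain ⟨ε, hε, hball⟩ := Metric.isOpen_iff.1 hopen 1 (by simpa using hxK)
    have hle : ray x ⊓ K ≤ ray ((1 + ε / 2) • x) := by
      rintro y ⟨hy, hyK⟩
      obtain ⟨c, hc, rfl⟩ := (mem_ray hx0).1 hy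
      have hcε : 1 + ε / 2 ≤ c := by
        by_contra! hlt
        refine hball ?_ hyK
        rw [Metric.mem_ball, Real.dist_eq, abs_lt]
        constructor <;> linarith
      refine (mem_ray (smul_ne_zero (by positivity) hx0)).2
        ⟨c / (1 + ε / 2), (one_le_div (by positivity)).2 hcε, ?_⟩
      rw [smul_smul, div_mul_cancel₀ _ (by positivity)]
    refine false_of_map_ray_le hn σ hx0 (t := 1 + ε / 2) (by linarith) ?_ hne
    calc σ (ray x) = σ (ray x ⊓ K) := by
          rw [map_inf, hKL, ← map_inf, inf_eq_left.2 (ray_le_iff.2 hxL)]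
      _ ≤ _ := OrderHomClass.mono σ hle
  exact fun K L h => le_antisymm (key L K h.symm) (key K L h)

theorem le_of_map_le {σ : LatticeHom (PC n) (PC n)} (hσ : Function.Injective σ) {K L : PC n}
    (h : σ K ≤ σ L) : K ≤ L := by
  rw [← inf_eq_left]
  apply hσ
  rw [map_inf, inf_eq_left.2 h]

/-! ### Dimension of images under injective endomorphisms -/

/-- The dimension of the linear span of a member of `PC n`. -/
noncomputable def rk (K : PC n) : ℕ := finrank ℝ (Submodule.span ℝ K.carrier)

theorem rk_mono {K L : PC n} (h : K ≤ L) : rk K ≤ rk L :=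
  Submodule.finrank_mono (Submodule.span_mono h)

/-- A member of `PC n` has interior points relative to its linear span. -/
theorem interior_nonempty {K : PC n} (hK : K ≠ ⊥)
    {W : Submodule ℝ (EuclideanSpace ℝ (Fin n))} (hW : Submodule.span ℝ K.carrier = W) :
    (interior ((↑) ⁻¹' K.carrier : Set W)).Nonempty := by
  subst hW
  set W := Submodule.span ℝ K.carrier
  set A : Set W := (↑) ⁻¹' K.carrier
  have hconv : Convex ℝ A := K.convex.linear_preimage W.subtype
  obtain ⟨p, hp⟩ := nonempty_of_ne_bot hK
  have hpA : (⟨p, Submodule.subset_span hp⟩ : W) ∈ A := hp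
  set p' : W := ⟨p, Submodule.subset_span hp⟩
  have h2p : (2 : ℝ) • p' ∈ A := K.smul_mem p hp 2 (by norm_num)
  rw [hconv.interior_nonempty_iff_affineSpan_eq_top]
  -- The line through `p` and `2 • p` passes through the origin, so affine and linear span coincide.
  have h0 : (0 : W) ∈ affineSpan ℝ A := by
    have h := AffineMap.lineMap_mem (-1 : ℝ) (subset_affineSpan ℝ A hpA)
      (subset_affineSpan ℝ A h2p)
    rw [AffineMap.lineMap_apply] at h
    convert h using 1
    simp only [vsub_eq_sub, vadd_eq_add]
    module
  rw [← AffineSubspace.direction_eq_top_iff_of_nonempty ⟨0, h0⟩, eq_top_iff,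
    ← Submodule.span_span_coe_preimage, Submodule.span_le]
  intro q hq
  have h := AffineSubspace.vsub_mem_direction (subset_affineSpan ℝ A hq) h0
  simpa using h

/-- Sets that pairwise meet only in `B` and are not contained in `B` cannot have the same linear
span for an uncountable set of indices. -/
theorem countable_of_span_eq {ι : Type*} {A : ι → PC n} {J : Set ι} {B : PC n}
    {W : Submodule ℝ (EuclideanSpace ℝ (Fin n))}
    (hAB : ∀ s ∈ J, ∀ t ∈ J, s ≠ t → A s ⊓ A t ≤ B) (hB : ∀ t ∈ J, ¬ A t ≤ B)
    (hW : ∀ t ∈ J, Submodule.span ℝ (A t).carrier = W) : J.Countable := by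
  have hBcl : IsClosed ((↑) ⁻¹' B.carrier : Set W) := B.isClosed.preimage continuous_subtype_val
  refine Set.PairwiseDisjoint.countable_of_isOpen
    (s := fun t => interior ((↑) ⁻¹' (A t).carrier : Set W) \ ((↑) ⁻¹' B.carrier : Set W)) ?_
    (fun t _ => isOpen_interior.sdiff hBcl) ?_
  · intro s hs t ht hst
    refine Set.disjoint_left.2 ?_
    rintro p ⟨hp1, hp2⟩ ⟨hp3, _⟩
    exact hp2 (hAB s hs t ht hst ⟨Set.mem_preimage.1 (interior_subset hp1),
      Set.mem_preimage.1 (interior_subset hp3)⟩)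
  · intro t ht
    by_contra hcon
    rw [Set.not_nonempty_iff_eq_empty, Set.sdiff_eq_empty] at hcon
    refine hB t ht fun p hp => ?_
    have hne : A t ≠ ⊥ := ne_bot_of_mem hp
    have hpW : p ∈ W := hW t ht ▸ Submodule.subset_span hp
    have hconv : Convex ℝ ((↑) ⁻¹' (A t).carrier : Set W) :=
      (A t).convex.linear_preimage W.subtype
    have hcl := hconv.closure_interior_eq_closure_of_nonempty_interior
      (interior_nonempty hne (hW t ht))
    have h1 : (⟨p, hpW⟩ : W) ∈ closure (interior ((↑) ⁻¹' (A t).carrier : Set W)) :=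
      hcl ▸ subset_closure hp
    exact closure_minimal hcon hBcl h1

/-- Among the slices through a member `K` of `PC n` there is one that still contains many
independent points, but has an image of smaller dimension than the image of `K`. -/
theorem exists_slice {σ : LatticeHom (PC n) (PC n)} (hσ : Function.Injective σ) {k : ℕ} {K : PC n}
    {x : Fin (k + 2) → EuclideanSpace ℝ (Fin n)} (hx : LinearIndependent ℝ x)
    (hxK : ∀ i, x i ∈ K.carrier) :
    ∃ L ≤ K, ∃ y : Fin (k + 1) → EuclideanSpace ℝ (Fin n), LinearIndependent ℝ y ∧
      (∀ i, y i ∈ L.carrier) ∧ rk (σ L) < rk (σ K) := by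
  obtain ⟨u, hu⟩ := exists_inner_eq hx fun _ => (-1 : ℝ)
  obtain ⟨a, ha⟩ := exists_inner_eq hx (Fin.snoc (α := fun _ => ℝ) (fun _ => (0 : ℝ)) (-1))
  -- The slices lie in the hyperplanes `⟨p, a⟩ = t * ⟨p, u⟩`; the condition `⟨p, u⟩ ≤ -1` makes them
  -- disjoint for different `t`. The point `y t i` is where the segment from `x i` to the last point
  -- crosses the slice.
  set D : ℝ → PC n := fun t => slice (Submodule.span ℝ {a - t • u})ᗮ u with hD
  have hmemD : ∀ t p, p ∈ (D t).carrier ↔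
      (inner ℝ p a : ℝ) = t * inner ℝ p u ∧ (inner ℝ p u : ℝ) ≤ -1 := by
    intro t p
    rw [hD, mem_slice, Submodule.mem_orthogonal_singleton_iff_inner_left, inner_sub_right,
      real_inner_smul_right, sub_eq_zero]
  set y : ℝ → Fin (k + 1) → EuclideanSpace ℝ (Fin n) :=
    fun t i => (1 - t) • x i.castSucc + t • x (Fin.last _) with hy
  have hyL : ∀ t ∈ Ioo (0 : ℝ) 1, ∀ i, y t i ∈ (K ⊓ D t).carrier := by
    intro t ht i
    refine ⟨K.convex (hxK _) (hxK _) (by linarith [ht.2]) ht.1.le (by ring), ?_⟩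
    rw [hmemD]
    simp only [hy, inner_add_left, real_inner_smul_left, hu, ha, Fin.snoc_castSucc, Fin.snoc_last]
    constructor
    · ring
    · linarith
  have hyind : ∀ t ∈ Ioo (0 : ℝ) 1, LinearIndependent ℝ (y t) := by
    intro t ht
    rw [Fintype.linearIndependent_iff] at hx ⊢
    intro c hc i
    have h := hx (Fin.snoc (α := fun _ => ℝ) (fun i => (1 - t) * c i) (t * ∑ i, c i)) (by
      rw [Fin.sum_univ_castSucc]
      simp only [Fin.snoc_castSucc, Fin.snoc_last]
      rw [← hc, mul_comm t, Finset.sum_mul, Finset.sum_smul, ← Finset.sum_add_distrib]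
      refine Finset.sum_congr rfl fun i _ => ?_
      simp only [hy]
      module) i.castSucc
    rw [Fin.snoc_castSucc] at h
    exact (mul_eq_zero.1 h).resolve_left (by linarith [ht.2])
  by_contra! hcon
  -- If no slice lowered the dimension of the image, all images would have the span of `σ K`, and
  -- the interval would be countable.
  have hspan : ∀ t ∈ Ioo (0 : ℝ) 1,
      Submodule.span ℝ (σ (K ⊓ D t)).carrier = Submodule.span ℝ (σ K).carrier := fun t ht =>
    Submodule.eq_of_le_of_finrank_le
      (Submodule.span_mono (OrderHomClass.mono σ (inf_le_left : K ⊓ D t ≤ K)))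
      (hcon _ inf_le_left (y t) (hyind t ht) (hyL t ht))
  have hcount : (Ioo (0 : ℝ) 1).Countable := by
    refine countable_of_span_eq (A := fun t => σ (K ⊓ D t)) (B := σ ⊥) ?_ ?_ hspan
    · intro s _ t _ hst
      rw [← map_inf]
      refine OrderHomClass.mono σ ?_
      rintro p ⟨⟨_, hps⟩, ⟨_, hpt⟩⟩
      rw [hmemD] at hps hpt
      have h1 := hps.1.symm.trans hpt.1
      exact (hst (mul_right_cancel₀ (by linarith [hps.2]) h1)).elim
    · intro t ht hle
      exact le_of_map_le hσ hle (hyL t ht 0)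
  exact zero_lt_one.not_ge (Cardinal.Real.Ioo_countable_iff.1 hcount)

/-- Each application of `exists_slice` costs one independent point and at least one dimension of the
image, and a single nonzero point still has an image of positive dimension. -/
theorem le_rk_map {σ : LatticeHom (PC n) (PC n)} (hσ : Function.Injective σ) {k : ℕ} {K : PC n}
    {x : Fin (k + 1) → EuclideanSpace ℝ (Fin n)} (hx : LinearIndependent ℝ x)
    (hxK : ∀ i, x i ∈ K.carrier) : k + 1 ≤ rk (σ K) := by
  induction k generalizing K with
  | zero =>
    by_contra! h
    have h0 : Submodule.span ℝ (σ K).carrier = ⊥ := Submodule.finrank_eq_zero.1 (by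
      unfold rk at h; omega)
    rw [Submodule.span_eq_bot] at h0
    obtain ⟨p, hp⟩ := nonempty_of_ne_bot (K := σ K) fun hbot =>
      (le_of_map_le hσ (hbot.trans_le bot_le) : K ≤ ⊥) (hxK 0)
    have htop : σ K = ⊤ := eq_top_iff_zero_mem.2 (h0 p hp ▸ hp)
    exact hx.ne_zero 0 (h0 _ (htop ▸ Set.mem_univ _))
  | succ k ih =>
    obtain ⟨L, hLK, y, hy, hyL, hlt⟩ := exists_slice hσ hx hxK
    have := ih hy hyL
    omega

/-- The bound of the rank by the number of points survives slicing, since both drop, and at one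
point it is the claim. -/
theorem exists_ray_rk_le_one {σ : LatticeHom (PC n) (PC n)} (hσ : Function.Injective σ) {k : ℕ}
    {K : PC n} {x : Fin (k + 1) → EuclideanSpace ℝ (Fin n)} (hx : LinearIndependent ℝ x)
    (hxK : ∀ i, x i ∈ K.carrier) (hK : rk (σ K) ≤ k + 1) :
    ∃ z ∈ K.carrier, rk (σ (ray z)) ≤ 1 := by
  induction k generalizing K with
  | zero =>
    exact ⟨x 0, hxK 0, (rk_mono (OrderHomClass.mono σ (ray_le_iff.2 (hxK 0)))).trans hK⟩
  | succ k ih =>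
    obtain ⟨L, hLK, y, hy, hyL, hlt⟩ := exists_slice hσ hx hxK
    obtain ⟨z, hz, hz1⟩ := ih hy hyL (by omega)
    exact ⟨z, hLK hz, hz1⟩

theorem exists_fin_of_span_eq_top {s : Set (EuclideanSpace ℝ (Fin n))}
    (hs : Submodule.span ℝ s = ⊤) :
    ∃ x : Fin n → EuclideanSpace ℝ (Fin n), LinearIndependent ℝ x ∧ ∀ i, x i ∈ s := by
  have h := Submodule.exists_fun_fin_finrank_span_eq ℝ s
  have hfr : finrank ℝ (Submodule.span ℝ s) = n := by
    rw [hs, finrank_top, finrank_euclideanSpace_fin]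
  rw [hfr] at h
  obtain ⟨f, hf, -, hind⟩ := h
  exact ⟨f, hind, hf⟩

theorem rk_le (K : PC n) : rk K ≤ n :=
  (Submodule.finrank_le _).trans_eq finrank_euclideanSpace_fin

/-- An open cone section contains `n` independent points, and an image has rank at most `n` anyway.
The second vector `q` serves to avoid a given hyperplane. -/
theorem exists_ray_rk_le_one_of_inner_neg (hn : 2 ≤ n) {σ : LatticeHom (PC n) (PC n)}
    (hσ : Function.Injective σ) {p w q : EuclideanSpace ℝ (Fin n)} (hw : (inner ℝ p w : ℝ) < 0)
    (hq : (inner ℝ p q : ℝ) < 0) :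
    ∃ z, (inner ℝ z w : ℝ) < 0 ∧ (inner ℝ z q : ℝ) < 0 ∧ rk (σ (ray z)) ≤ 1 := by
  have hopen : IsOpen {z : EuclideanSpace ℝ (Fin n) |
      (inner ℝ z w : ℝ) < -1 ∧ (inner ℝ z q : ℝ) < -1} := by
    have h : ∀ v : EuclideanSpace ℝ (Fin n),
        IsOpen {z : EuclideanSpace ℝ (Fin n) | (inner ℝ z v : ℝ) < -1} := fun v =>
      isOpen_lt (by fun_prop) continuous_const
    exact (h w).inter (h q)
  have hne : {z : EuclideanSpace ℝ (Fin n) |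
      (inner ℝ z w : ℝ) < -1 ∧ (inner ℝ z q : ℝ) < -1}.Nonempty := by
    have hpos : 0 < min (-(inner ℝ p w : ℝ)) (-(inner ℝ p q : ℝ)) :=
      lt_min (by linarith) (by linarith)
    set m := min (-(inner ℝ p w : ℝ)) (-(inner ℝ p q : ℝ))
    have h2 : 2 / m * m = 2 := div_mul_cancel₀ _ hpos.ne'
    have h3 : 0 < 2 / m := by positivity
    refine ⟨(2 / m) • p, ?_, ?_⟩
    · rw [real_inner_smul_left]
      nlinarith [min_le_left (-(inner ℝ p w : ℝ)) (-(inner ℝ p q : ℝ))]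
    · rw [real_inner_smul_left]
      nlinarith [min_le_right (-(inner ℝ p w : ℝ)) (-(inner ℝ p q : ℝ))]
  have hspan := Submodule.eq_top_of_nonempty_interior' (R := ℝ)
    (Submodule.span ℝ {z : EuclideanSpace ℝ (Fin n) |
      (inner ℝ z w : ℝ) < -1 ∧ (inner ℝ z q : ℝ) < -1})
    (hne.mono (interior_maximal Submodule.subset_span hopen))
  obtain ⟨x, hx, hxs⟩ := exists_fin_of_span_eq_top hspan
  obtain ⟨k, rfl⟩ : ∃ k, n = k + 1 := ⟨n - 1, by omega⟩
  obtain ⟨z, hz, hz1⟩ := exists_ray_rk_le_one hσ (K := hs w ⊓ hs q) hx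
    (fun i => ⟨mem_hs.2 (hxs i).1.le, mem_hs.2 (hxs i).2.le⟩) (rk_le _)
  exact ⟨z, by linarith [mem_hs.1 hz.1], by linarith [mem_hs.1 hz.2], hz1⟩

theorem eq_ray_of_rk_le_one {K : PC n} (hbot : K ≠ ⊥) (htop : K ≠ ⊤) (hK : rk K ≤ 1) :
    ∃ y, y ≠ 0 ∧ K = ray y := by
  obtain ⟨p, hp⟩ := nonempty_of_ne_bot hbot
  have h0 : (0 : EuclideanSpace ℝ (Fin n)) ∉ K.carrier := fun h =>
    htop (eq_top_iff_zero_mem.2 h)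
  have hp0 : p ≠ 0 := fun h => h0 (h ▸ hp)
  have hspan : Submodule.span ℝ {p} = Submodule.span ℝ K.carrier :=
    Submodule.eq_of_le_of_finrank_le (Submodule.span_mono (Set.singleton_subset_iff.2 hp))
      (by rw [finrank_span_singleton hp0]; exact hK)
  set S : Set ℝ := {c | c • p ∈ K.carrier} with hS
  have hScl : IsClosed S :=
    K.isClosed.preimage (by fun_prop : Continuous fun s : ℝ => s • p)
  -- A scalar `c ≤ 0` would put `c • p + (-c) • p = 0` into `K`. The ray then starts at the infimum
  -- of `S`.
  have hSpos : ∀ c ∈ S, 0 < c := by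
    intro c hc
    by_contra! hneg
    have h1 := K.comb_mem hc hp (a := 1) (b := -c) zero_le_one (by linarith) (by linarith)
    exact h0 (by simpa using h1)
  have hSbdd : BddBelow S := ⟨0, fun c hc => (hSpos c hc).le⟩
  have hc0 : sInf S ∈ S := hScl.csInf_mem ⟨1, by simpa [hS] using hp⟩ hSbdd
  have hpos := hSpos _ hc0
  refine ⟨sInf S • p, smul_ne_zero hpos.ne' hp0, le_antisymm ?_ (ray_le_iff.2 hc0)⟩
  intro q hq
  obtain ⟨c, rfl⟩ := Submodule.mem_span_singleton.1
    (hspan ▸ Submodule.subset_span hq : q ∈ Submodule.span ℝ {p})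
  refine (mem_ray (smul_ne_zero hpos.ne' hp0)).2
    ⟨c / sInf S, (one_le_div hpos).2 (csInf_le hSbdd hq), ?_⟩
  rw [smul_smul, div_mul_cancel₀ _ hpos.ne']

theorem map_ray_eq_ray_of_rk_le_one (hn : 2 ≤ n) {σ : LatticeHom (PC n) (PC n)}
    (hσ : Function.Injective σ) {z : EuclideanSpace ℝ (Fin n)} (hz : rk (σ (ray z)) ≤ 1) :
    ∃ y, y ≠ 0 ∧ σ (ray z) = ray y := by
  refine eq_ray_of_rk_le_one ?_ ?_ hz
  · intro h
    exact ray_ne_bot z (le_bot_iff.1 (le_of_map_le hσ (h.trans_le bot_le)))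
  · intro h
    rw [h, rk, carrier_top, Submodule.span_univ, finrank_top, finrank_euclideanSpace_fin] at hz
    omega

theorem map_ne_top {σ : LatticeHom (PC n) (PC n)} (hσ : Function.Injective σ) {K : PC n}
    (hK : K ≠ ⊤) : σ K ≠ ⊤ := fun h =>
  hK (top_le_iff.1 (le_of_map_le hσ (le_top.trans_eq h.symm)))

theorem hs_ne_top (u : EuclideanSpace ℝ (Fin n)) : hs u ≠ ⊤ := by
  rw [Ne, eq_top_iff_zero_mem, mem_hs, inner_zero_left]
  norm_num

/-- If independent rays are mapped to rays, then the image rays span the space. -/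
theorem span_range_eq_top (hn : 2 ≤ n) {σ : LatticeHom (PC n) (PC n)}
    (hσ : Function.Injective σ) {z y : Fin n → EuclideanSpace ℝ (Fin n)}
    (hz : LinearIndependent ℝ z) (hzy : ∀ i, σ (ray (z i)) = ray (y i)) :
    Submodule.span ℝ (Set.range y) = ⊤ := by
  obtain ⟨k, rfl⟩ : ∃ k, n = k + 1 := ⟨n - 1, by omega⟩
  set S := Finset.univ.sup' Finset.univ_nonempty fun i => ray (z i) with hS
  have hσS : σ S = Finset.univ.sup' Finset.univ_nonempty fun i => ray (y i) := by
    rw [hS, Finset.apply_sup'_eq_sup'_comp _ σ (map_sup σ)]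
    exact Finset.sup'_congr _ rfl fun i _ => hzy i
  obtain ⟨u, hu⟩ := exists_inner_eq hz fun _ => (-1 : ℝ)
  have hSu : S ≤ hs u := Finset.sup'_le _ _ fun i _ => ray_le_iff.2 (mem_hs.2 (hu i).le)
  -- This excludes the case in which the join of the image rays jumps to the whole space; only then
  -- is it confined to a slice of their span.
  have hStop : σ S ≠ ⊤ := map_ne_top hσ fun h => hs_ne_top u (top_le_iff.1 (h ▸ hSu))
  obtain ⟨v, hv, -⟩ := exists_mem_dual_of_notMem fun h => hStop (eq_top_iff_zero_mem.2 h)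
  have hy : ∀ i, y i ∈ (σ S).carrier := fun i => by
    rw [← ray_le_iff, hσS]
    exact Finset.le_sup' (fun i => ray (y i)) (Finset.mem_univ i)
  have hle : σ S ≤ slice (Submodule.span ℝ (Set.range y)) v := by
    conv_lhs => rw [hσS]
    refine Finset.sup'_le _ _ fun i _ => ray_le_iff.2 ⟨Submodule.subset_span ⟨i, rfl⟩, ?_⟩
    exact mem_hs.1 ((le_hs_iff.2 hv) (hy i))
  have hrk : k + 1 ≤ rk (σ S) := le_rk_map hσ hz fun i => by
    rw [← ray_le_iff]
    exact Finset.le_sup' (fun i => ray (z i)) (Finset.mem_univ i)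
  apply Submodule.eq_top_of_finrank_eq
  refine le_antisymm (Submodule.finrank_le _) ?_
  rw [finrank_euclideanSpace_fin]
  exact hrk.trans (Submodule.finrank_mono (Submodule.span_le.2 fun p hp => (hle hp).1))

/-! ### Rays go to rays, half-spaces to half-spaces -/

/-- The endomorphism `K ↦ (σ (K*))*`. -/
noncomputable def conj (σ : LatticeHom (PC n) (PC n)) : LatticeHom (PC n) (PC n) where
  toFun K := (σ K.dual).dual
  map_sup' K L := by rw [dual_sup, map_inf, dual_inf]
  map_inf' K L := by rw [dual_inf, map_sup, dual_sup]

theorem conj_apply (σ : LatticeHom (PC n) (PC n)) (K : PC n) : conj σ K = (σ K.dual).dual := rfl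

theorem conj_injective {σ : LatticeHom (PC n) (PC n)} (hσ : Function.Injective σ) :
    Function.Injective (conj σ) := fun _ _ h => dual_injective (hσ (dual_injective h))

/-- Two half-spaces with the same nontrivial intersection with `F` have normal vectors that agree
on `F`. -/
theorem inner_eq_of_inf_hs_eq {F : PC n} {v v' : EuclideanSpace ℝ (Fin n)}
    (h : F ⊓ hs v = F ⊓ hs v') (hbot : F ⊓ hs v ≠ ⊥) (hF : ¬ F ≤ hs v)
    {p : EuclideanSpace ℝ (Fin n)} (hp : p ∈ F.carrier) :
    (inner ℝ p v : ℝ) = inner ℝ p v' := by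
  have hiff : ∀ q ∈ F.carrier, (inner ℝ q v : ℝ) ≤ -1 ↔ (inner ℝ q v' : ℝ) ≤ -1 := by
    intro q hq
    have h1 : q ∈ (F ⊓ hs v).carrier ↔ q ∈ (F ⊓ hs v').carrier := by rw [h]
    simpa [carrier_inf, hq, mem_hs] using h1
  -- In this strip the dilates `c • q`, `c ≥ 1`, enter `hs v` exactly at `c = -1 / ⟨q, v⟩`, and they
  -- enter `hs v'` at the same moment.
  have near : ∀ q ∈ F.carrier, -1 < (inner ℝ q v : ℝ) → (inner ℝ q v : ℝ) < 0 →
      (inner ℝ q v : ℝ) = inner ℝ q v' := by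
    intro q hq h1 h0
    have h1' : -1 < (inner ℝ q v' : ℝ) := by
      by_contra! hc
      linarith [(hiff q hq).2 hc]
    set s := (inner ℝ q v : ℝ)
    set s' := (inner ℝ q v' : ℝ)
    have hscale : ∀ c : ℝ, 1 ≤ c → (c * s ≤ -1 ↔ c * s' ≤ -1) := by
      intro c hc
      have := hiff _ (F.smul_mem q hq c hc)
      rwa [real_inner_smul_left, real_inner_smul_left] at this
    have hs0 : (-s)⁻¹ * s = -1 := by rw [inv_neg, neg_mul, inv_mul_cancel₀ h0.ne]
    have h2 := (hscale (-s)⁻¹ ((one_le_inv₀ (by linarith)).2 (by linarith))).1 hs0.le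
    have h3 : s' ≤ s := by
      rw [inv_mul_le_iff₀ (by linarith)] at h2
      linarith
    have h0' : s' < 0 := by linarith
    have hs0' : (-s')⁻¹ * s' = -1 := by rw [inv_neg, neg_mul, inv_mul_cancel₀ h0'.ne]
    have h4 := (hscale (-s')⁻¹ ((one_le_inv₀ (by linarith)).2 (by linarith))).2 hs0'.le
    rw [inv_mul_le_iff₀ (by linarith)] at h4
    linarith
  obtain ⟨r, hrF, hr⟩ := nonempty_of_ne_bot hbot
  rw [mem_hs] at hr
  obtain ⟨q, hqF, hq⟩ := Set.not_subset.1 hF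
  rw [mem_hs, not_le] at hq
  obtain ⟨q₀, hq₀F, hq₀, hq₀'⟩ : ∃ q₀ ∈ F.carrier, -1 < (inner ℝ q₀ v : ℝ) ∧
      (inner ℝ q₀ v : ℝ) < 0 := by
    rcases lt_or_ge (inner ℝ q v : ℝ) 0 with hneg | hnn
    · exact ⟨q, hqF, hq, hneg⟩
    · set a := (inner ℝ q v : ℝ)
      set b := (inner ℝ r v : ℝ)
      have hab : 0 < a - b := by linarith
      refine ⟨((-1 / 2 - b) / (a - b)) • q + ((a + 1 / 2) / (a - b)) • r,
        F.convex hqF hrF (div_nonneg (by linarith) hab.le) (div_nonneg (by linarith) hab.le)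
          (by field_simp; ring), ?_⟩
      have : (inner ℝ (((-1 / 2 - b) / (a - b)) • q + ((a + 1 / 2) / (a - b)) • r) v : ℝ)
          = -1 / 2 := by
        rw [inner_add_left, real_inner_smul_left, real_inner_smul_left]
        change (-1 / 2 - b) / (a - b) * a + (a + 1 / 2) / (a - b) * b = -1 / 2
        field_simp
        ring
      rw [this]
      norm_num
  -- A short move from `q₀` towards `p` stays in the strip, and linearity carries the equality on to
  -- `p`.
  have hcont : Continuous fun ε : ℝ => (1 - ε) * (inner ℝ q₀ v : ℝ) + ε * inner ℝ p v := by
    fun_prop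
  have hopen : IsOpen {ε : ℝ | (1 - ε) * (inner ℝ q₀ v : ℝ) + ε * inner ℝ p v ∈ Ioo (-1 : ℝ) 0} :=
    isOpen_Ioo.preimage hcont
  obtain ⟨δ, hδ, hball⟩ := Metric.isOpen_iff.1 hopen 0 (by simpa using ⟨hq₀, hq₀'⟩)
  set ε := min (δ / 2) 1
  have hε : 0 < ε := lt_min (by linarith) one_pos
  have hε1 : ε ≤ 1 := min_le_right _ _
  have hεδ : ε ≤ δ / 2 := min_le_left _ _
  have h1 : (1 - ε) * (inner ℝ q₀ v : ℝ) + ε * inner ℝ p v ∈ Ioo (-1 : ℝ) 0 := by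
    refine hball ?_
    rw [Metric.mem_ball, Real.dist_eq, sub_zero, abs_of_pos hε]
    linarith
  have h2 := near ((1 - ε) • q₀ + ε • p) (F.convex hq₀F hp (by linarith) hε.le (by ring))
  rw [inner_add_left, inner_add_left, real_inner_smul_left, real_inner_smul_left,
    real_inner_smul_left, real_inner_smul_left] at h2
  have h3 := h2 h1.1 h1.2
  rw [near q₀ hq₀F hq₀ hq₀'] at h3
  exact mul_left_cancel₀ hε.ne' (by linarith)

/-- An injective endomorphism maps rays to sets of dimension at most one. -/
theorem rk_map_ray_le_one (hn : 2 ≤ n) {σ : LatticeHom (PC n) (PC n)} (hσ : Function.Injective σ)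
    {x : EuclideanSpace ℝ (Fin n)} (hx : x ≠ 0) : rk (σ (ray x)) ≤ 1 := by
  have hσ' := conj_injective hσ
  have hspan : Submodule.span ℝ {u : EuclideanSpace ℝ (Fin n) |
      (inner ℝ x u : ℝ) < 0 ∧ rk (conj σ (ray u)) ≤ 1} = ⊤ := by
    by_contra hne
    rw [← Submodule.orthogonal_eq_bot_iff] at hne
    obtain ⟨q, hq, hq0⟩ := Submodule.exists_mem_ne_zero_of_ne_bot hne
    have hperp : ∀ z : EuclideanSpace ℝ (Fin n), (inner ℝ z x : ℝ) < 0 →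
        rk (conj σ (ray z)) ≤ 1 → (inner ℝ z q : ℝ) = 0 := by
      intro z h1 h2
      rw [real_inner_comm] at h1
      have hz : z ∈ {u : EuclideanSpace ℝ (Fin n) |
        (inner ℝ x u : ℝ) < 0 ∧ rk (conj σ (ray u)) ≤ 1} := ⟨h1, h2⟩
      exact Submodule.inner_right_of_mem_orthogonal (Submodule.subset_span hz) hq
    -- The contradiction needs a good ray pairing negatively with `x` and nontrivially with `q`; if
    -- `q` is a multiple of `x`, the first implies the second.
    by_cases hind : LinearIndependent ℝ ![x, q]
    · obtain ⟨p, hpx, hpq⟩ := exists_inner_pair hind (-1) (-1)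
      obtain ⟨z, hzx, hzq, hz⟩ := exists_ray_rk_le_one_of_inner_neg hn hσ' (p := p) (w := x)
        (q := q) (by rw [real_inner_comm, hpx]; norm_num) (by rw [real_inner_comm, hpq]; norm_num)
      exact hzq.ne (hperp z hzx hz)
    · rw [LinearIndependent.pair_iff' hx] at hind
      push Not at hind
      obtain ⟨a, rfl⟩ := hind
      have hneg : (inner ℝ (-x) x : ℝ) < 0 := by
        rw [inner_neg_left]
        linarith [real_inner_self_pos.2 hx]
      obtain ⟨z, hzx, -, hz⟩ := exists_ray_rk_le_one_of_inner_neg hn hσ' hneg hneg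
      have h1 := hperp z hzx hz
      rw [real_inner_smul_right] at h1
      rcases mul_eq_zero.1 h1 with h1 | h1
      · exact hq0 (by rw [h1, zero_smul])
      · exact hzx.ne h1
  obtain ⟨u, hu, hu1⟩ := exists_fin_of_span_eq_top hspan
  -- `c` exceeds every `-⟨x, u i⟩`, so factors `s i ≥ 1` achieve `⟨x, s i • u i⟩ = -c`; stretching
  -- by such factors keeps the image rays of rank at most one.
  set c : ℝ := 1 + ∑ i, -(inner ℝ x (u i) : ℝ) with hc
  have hsum : ∀ i, -(inner ℝ x (u i) : ℝ) ≤ c - 1 := fun i => by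
    have := Finset.single_le_sum (f := fun i => -(inner ℝ x (u i) : ℝ))
      (fun i _ => by linarith [(hu1 i).1]) (Finset.mem_univ i)
    rw [hc, add_sub_cancel_left]
    exact this
  have hc1 : 1 ≤ c := by
    have := hsum ⟨0, by omega⟩
    linarith [(hu1 ⟨0, by omega⟩).1]
  set s : Fin n → ℝ := fun i => c / -(inner ℝ x (u i) : ℝ) with hs_def
  have hs1 : ∀ i, 1 ≤ s i := fun i =>
    (one_le_div (by linarith [(hu1 i).1])).2 (by linarith [hsum i])
  have hus : LinearIndependent ℝ fun i => s i • u i := by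
    rw [Fintype.linearIndependent_iff] at hu ⊢
    intro g hg i
    have := hu (fun i => g i * s i) (by simpa [mul_smul] using hg) i
    exact (mul_eq_zero.1 this).resolve_right (by linarith [hs1 i])
  have hgood : ∀ i, ∃ v, v ≠ 0 ∧ conj σ (ray (s i • u i)) = ray v := fun i =>
    map_ray_eq_ray_of_rk_le_one hn hσ'
      ((rk_mono (OrderHomClass.mono _ (ray_smul_le (u i) (hs1 i)))).trans (hu1 i).2)
  choose v hv0 hv using hgood
  have hvspan := span_range_eq_top hn hσ' hus hv
  have hhs : ∀ i, σ (hs (s i • u i)) = hs (v i) := fun i => by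
    have h1 := congrArg dual (hv i)
    rwa [conj_apply, dual_dual, dual_ray, dual_ray] at h1
  have hcpos : 0 < c := by linarith
  -- Now `⟨x', s i • u i⟩ = -1/2`, so all `n` half-spaces cut `ray x'` at the same point `2 • x'`.
  -- Hence the `v i` agree on `F`.
  set x' := (2 * c)⁻¹ • x with hx'
  have hx'0 : x' ≠ 0 := smul_ne_zero (by positivity) hx
  have hinf : ∀ i, ray x' ⊓ hs (s i • u i) = ray ((2 : ℝ)⁻¹⁻¹ • x') := fun i => by
    refine ray_inf_hs (by norm_num) (by norm_num) ?_
    have : (inner ℝ x (u i) : ℝ) ≠ 0 := (hu1 i).1.ne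
    rw [hx', real_inner_smul_left, real_inner_smul_right, hs_def]
    field_simp
  rw [inv_inv] at hinf
  set F := σ (ray x') with hF
  have hFinf : ∀ i, F ⊓ hs (v i) = σ (ray ((2 : ℝ) • x')) := fun i => by
    rw [hF, ← hhs, ← map_inf, hinf]
  have hle : ray x ≤ ray x' := by
    have : x = (2 * c) • x' := by rw [hx', smul_smul, mul_inv_cancel₀ (by positivity), one_smul]
    rw [this]
    exact ray_smul_le _ (by linarith)
  refine (rk_mono (OrderHomClass.mono σ hle)).trans ?_
  have hinner : ∀ i j, ∀ p ∈ F.carrier, (inner ℝ p (v i) : ℝ) = inner ℝ p (v j) := by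
    intro i j p hp
    refine inner_eq_of_inf_hs_eq ((hFinf i).trans (hFinf j).symm) ?_ ?_ hp
    · rw [hFinf]
      intro h
      exact ray_ne_bot _ (le_bot_iff.1 (le_of_map_le hσ (h.trans_le bot_le)))
    · intro h
      rw [← inf_eq_left, hFinf] at h
      have h1 : x' ∈ (ray ((2 : ℝ) • x')).carrier := ray_le_iff.1 (hσ h).ge
      obtain ⟨d, hd, h2⟩ := (mem_ray (smul_ne_zero two_ne_zero hx'0)).1 h1
      rw [smul_smul] at h2
      have h3 : (d * 2 - 1) • x' = 0 := by rw [sub_smul, ← h2, one_smul, sub_self]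
      rcases smul_eq_zero.1 h3 with h3 | h3
      · linarith
      · exact hx'0 h3
  let i₀ : Fin n := ⟨0, by omega⟩
  have hspanF : ∀ i, ∀ p ∈ Submodule.span ℝ F.carrier,
      (inner ℝ p (v i) : ℝ) = inner ℝ p (v i₀) := by
    intro i p hp
    induction hp using Submodule.span_induction with
    | mem p hp => exact hinner i i₀ p hp
    | zero => simp
    | add p q _ _ hp hq => rw [inner_add_left, inner_add_left, hp, hq]
    | smul a p _ hp => rw [real_inner_smul_left, real_inner_smul_left, hp]
  -- A vector of the span of `F` killed by `v i₀` is orthogonal to all `v i`, which span the space.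
  -- One functional is thus injective on this span.
  have hker : Function.Injective
      ((innerₗ (EuclideanSpace ℝ (Fin n)) (v i₀)).comp (Submodule.span ℝ F.carrier).subtype) := by
    rw [injective_iff_map_eq_zero]
    rintro ⟨p, hp⟩ h
    have h0 : (inner ℝ p (v i₀) : ℝ) = 0 := by rw [real_inner_comm]; exact h
    have hp0 : p ∈ (Submodule.span ℝ (Set.range v))ᗮ := by
      rw [Submodule.mem_orthogonal']
      intro w hw
      induction hw using Submodule.span_induction with
      | mem w hw =>
        obtain ⟨i, rfl⟩ := hw
        rw [hspanF i p hp, h0]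
      | zero => simp
      | add w w' _ _ h1 h2 => rw [inner_add_right, h1, h2, add_zero]
      | smul a w _ h1 => rw [real_inner_smul_right, h1, mul_zero]
    rw [hvspan, Submodule.top_orthogonal_eq_bot, Submodule.mem_bot] at hp0
    exact Subtype.ext hp0
  have := LinearMap.finrank_le_finrank_of_injective hker
  rwa [finrank_self] at this

theorem exists_map_ray_eq (hn : 2 ≤ n) {σ : LatticeHom (PC n) (PC n)} (hσ : Function.Injective σ)
    {x : EuclideanSpace ℝ (Fin n)} (hx : x ≠ 0) : ∃ y, y ≠ 0 ∧ σ (ray x) = ray y :=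
  map_ray_eq_ray_of_rk_le_one hn hσ (rk_map_ray_le_one hn hσ hx)

theorem exists_map_hs_eq (hn : 2 ≤ n) {σ : LatticeHom (PC n) (PC n)} (hσ : Function.Injective σ)
    {u : EuclideanSpace ℝ (Fin n)} (hu : u ≠ 0) : ∃ v, v ≠ 0 ∧ σ (hs u) = hs v := by
  obtain ⟨v, hv, h⟩ := exists_map_ray_eq hn (conj_injective hσ) hu
  refine ⟨v, hv, ?_⟩
  have h1 := congrArg dual h
  rwa [conj_apply, dual_dual, dual_ray, dual_ray] at h1

/-- If the image rays of two independent rays had a common point, they would be comparable, and so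
would the original rays. -/
theorem map_bot_eq (hn : 2 ≤ n) {σ : LatticeHom (PC n) (PC n)} (hσ : Function.Injective σ) :
    σ ⊥ = ⊥ := by
  obtain ⟨x, hx⟩ := @exists_ne (EuclideanSpace ℝ (Fin n))
    (nontrivial_of_finrank_pos (R := ℝ) (by rw [finrank_euclideanSpace_fin]; omega)) 0
  obtain ⟨y, hxy⟩ := exists_pair hn hx
  obtain ⟨a, ha, hσa⟩ := exists_map_ray_eq hn hσ hx
  obtain ⟨b, hb, hσb⟩ := exists_map_ray_eq hn hσ (x := y) (hxy.ne_zero 1)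
  have hno : ∀ x y : EuclideanSpace ℝ (Fin n), LinearIndependent ℝ ![x, y] →
      ¬ σ (ray x) ≤ σ (ray y) := by
    intro x y h hle
    have h1 : ray x ⊓ ray y = ray x := inf_eq_left.2 (le_of_map_le hσ hle)
    rw [ray_inf_ray h] at h1
    exact ray_ne_bot x h1.symm
  have hinf : σ ⊥ = σ (ray x) ⊓ σ (ray y) := by rw [← map_inf, ray_inf_ray hxy]
  rw [hinf]
  by_contra hne
  obtain ⟨p, hpa, hpb⟩ := nonempty_of_ne_bot hne
  rw [hσa] at hpa
  rw [hσb] at hpb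
  obtain ⟨c, hc, rfl⟩ := (mem_ray ha).1 hpa
  obtain ⟨d, hd, hcd⟩ := (mem_ray hb).1 hpb
  have hyx : LinearIndependent ℝ ![y, x] := LinearIndependent.pair_symm_iff.1 hxy
  rcases le_total c d with h | h
  · apply hno x y hxy
    rw [hσa, hσb, ray_le_iff, mem_ray hb]
    refine ⟨d / c, (one_le_div (by linarith)).2 h, ?_⟩
    rw [div_eq_inv_mul, mul_smul, ← hcd, inv_smul_smul₀ (by linarith)]
  · apply hno y x hyx
    rw [hσa, hσb, ray_le_iff, mem_ray ha]
    refine ⟨c / d, (one_le_div (by linarith)).2 h, ?_⟩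
    rw [div_eq_inv_mul, mul_smul, hcd, inv_smul_smul₀ (by linarith)]

theorem ray_injective {x y : EuclideanSpace ℝ (Fin n)} (hx : x ≠ 0) (hy : y ≠ 0)
    (h : ray x = ray y) : x = y := by
  obtain ⟨c, hc, hxc⟩ := (mem_ray hy).1 (ray_le_iff.1 h.le)
  obtain ⟨d, hd, hyd⟩ := (mem_ray hx).1 (ray_le_iff.1 h.ge)
  have h1 : (c * d - 1) • x = 0 := by rw [sub_smul, mul_smul, ← hyd, ← hxc, one_smul, sub_self]
  have h2 : c * d - 1 = 0 := (smul_eq_zero.1 h1).resolve_right hx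
  have h3 : c = 1 := by nlinarith
  rw [hxc, h3, one_smul]

/-! ### The transformed inner product -/

/-- The injective endomorphism `σ` maps rays to rays by `φ` and half-spaces to half-spaces
by `ψ`. -/
structure IsRep (σ : LatticeHom (PC n) (PC n))
    (φ ψ : EuclideanSpace ℝ (Fin n) → EuclideanSpace ℝ (Fin n)) : Prop where
  inj : Function.Injective σ
  ne_zero : ∀ x, x ≠ 0 → φ x ≠ 0
  map_ray : ∀ x, x ≠ 0 → σ (ray x) = ray (φ x)
  ne_zero' : ∀ u, u ≠ 0 → ψ u ≠ 0
  map_hs : ∀ u, u ≠ 0 → σ (hs u) = hs (ψ u)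

theorem exists_isRep (hn : 2 ≤ n) {σ : LatticeHom (PC n) (PC n)} (hσ : Function.Injective σ) :
    ∃ φ ψ, IsRep σ φ ψ := by
  have h1 : ∀ x : EuclideanSpace ℝ (Fin n), ∃ y, x ≠ 0 → y ≠ 0 ∧ σ (ray x) = ray y := fun x => by
    by_cases hx : x = 0
    · exact ⟨0, fun h => (h hx).elim⟩
    · obtain ⟨y, hy⟩ := exists_map_ray_eq hn hσ hx
      exact ⟨y, fun _ => hy⟩
  have h2 : ∀ x : EuclideanSpace ℝ (Fin n), ∃ y, x ≠ 0 → y ≠ 0 ∧ σ (hs x) = hs y := fun x => by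
    by_cases hx : x = 0
    · exact ⟨0, fun h => (h hx).elim⟩
    · obtain ⟨y, hy⟩ := exists_map_hs_eq hn hσ hx
      exact ⟨y, fun _ => hy⟩
  choose φ hφ using h1
  choose ψ hψ using h2
  exact ⟨φ, ψ, hσ, fun x hx => (hφ x hx).1, fun x hx => (hφ x hx).2, fun x hx => (hψ x hx).1,
    fun x hx => (hψ x hx).2⟩

theorem ne_zero_of_inner_eq_neg {x u : EuclideanSpace ℝ (Fin n)} {c : ℝ} (hc : 0 < c)
    (h : (inner ℝ x u : ℝ) = -c) : x ≠ 0 ∧ u ≠ 0 := by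
  constructor
  · rintro rfl
    rw [inner_zero_left] at h
    linarith
  · rintro rfl
    rw [inner_zero_right] at h
    linarith

namespace IsRep

variable {σ : LatticeHom (PC n) (PC n)} {φ ψ : EuclideanSpace ℝ (Fin n) → EuclideanSpace ℝ (Fin n)}

theorem conj (h : IsRep σ φ ψ) : IsRep (PC.conj σ) ψ φ where
  inj := conj_injective h.inj
  ne_zero := h.ne_zero'
  map_ray u hu := by rw [conj_apply, dual_ray, h.map_hs u hu, dual_hs]
  ne_zero' := h.ne_zero
  map_hs x hx := by rw [conj_apply, dual_hs, h.map_ray x hx, dual_ray]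

/-- The relation is expressible in the lattice: `hs u` cuts from the longer ray through `x / 2`
exactly `ray x`. The image half-space must make a proper cut too, by injectivity. -/
theorem inner_eq_neg_one (h : IsRep σ φ ψ) {x u : EuclideanSpace ℝ (Fin n)}
    (hxu : (inner ℝ x u : ℝ) = -1) : (inner ℝ (φ x) (ψ u) : ℝ) = -1 := by
  obtain ⟨hx, hu⟩ := ne_zero_of_inner_eq_neg one_pos hxu
  set x' := (2 : ℝ)⁻¹ • x
  have hx' : x' ≠ 0 := smul_ne_zero (by norm_num) hx
  have hinf : ray x' ⊓ hs u = ray x := by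
    rw [ray_inf_hs (c := (2 : ℝ)⁻¹) (by norm_num) (by norm_num)
      (by rw [real_inner_smul_left, hxu]; norm_num), inv_inv, smul_inv_smul₀ two_ne_zero]
  have hinf' : ray (φ x') ⊓ hs (ψ u) = ray (φ x) := by
    rw [← h.map_ray _ hx', ← h.map_hs _ hu, ← map_inf, hinf, h.map_ray _ hx]
  have hmem : φ x ∈ (ray (φ x') ⊓ hs (ψ u)).carrier := hinf' ▸ self_mem_ray _
  obtain ⟨c, hc, hcx⟩ := (mem_ray (h.ne_zero _ hx')).1 hmem.1
  have hle := mem_hs.1 hmem.2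
  rw [hcx, real_inner_smul_left] at hle
  set d := (inner ℝ (φ x') (ψ u) : ℝ) with hd
  have hd0 : d < 0 := by nlinarith
  rcases le_or_gt (-1) d with hd1 | hd1
  · rw [ray_inf_hs (c := -d) (by linarith) (by linarith) (by rw [neg_neg])] at hinf'
    rw [← ray_injective (smul_ne_zero (inv_ne_zero (by linarith)) (h.ne_zero _ hx'))
      (h.ne_zero _ hx) hinf', real_inner_smul_left, ← hd, inv_neg, neg_mul, inv_mul_cancel₀ hd0.ne]
  · rw [inf_eq_left.2 (ray_le_iff.2 (mem_hs.2 hd1.le)), ← h.map_ray _ hx', ← h.map_ray _ hx] at hinf'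
    have h1 := ray_injective hx' hx (h.inj hinf')
    have h2 : ((2 : ℝ)⁻¹ - 1) • x = 0 := by rw [sub_smul, one_smul, sub_eq_zero]; exact h1
    rcases smul_eq_zero.1 h2 with h2 | h2
    · norm_num at h2
    · exact (hx h2).elim

theorem exists_map_smul (h : IsRep σ φ ψ) {x : EuclideanSpace ℝ (Fin n)} (hx : x ≠ 0) {c : ℝ}
    (hc : 0 < c) : ∃ m : ℝ, 0 < m ∧ φ (c • x) = m • φ x := by
  have hcx : c • x ≠ 0 := smul_ne_zero hc.ne' hx
  rcases le_total 1 c with h1 | h1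
  · have hle : ray (φ (c • x)) ≤ ray (φ x) := by
      rw [← h.map_ray _ hx, ← h.map_ray _ hcx]
      exact OrderHomClass.mono σ (ray_smul_le x h1)
    obtain ⟨m, hm, hm'⟩ := (mem_ray (h.ne_zero _ hx)).1 (ray_le_iff.1 hle)
    exact ⟨m, by linarith, hm'⟩
  · have hle : ray (φ x) ≤ ray (φ (c • x)) := by
      rw [← h.map_ray _ hx, ← h.map_ray _ hcx]
      refine OrderHomClass.mono σ ?_
      have := ray_smul_le (c • x) ((one_le_inv₀ hc).2 h1)
      rwa [inv_smul_smul₀ hc.ne'] at this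
    obtain ⟨m, hm, hm'⟩ := (mem_ray (h.ne_zero _ hcx)).1 (ray_le_iff.1 hle)
    have hm0 : 0 < m := by linarith
    exact ⟨m⁻¹, inv_pos.2 hm0, by rw [hm', inv_smul_smul₀ hm0.ne']⟩

/-- The values of the transformed inner product over the points `u` with `⟨x, u⟩ = -c`. -/
theorem exists_mul_inner_eq (h : IsRep σ φ ψ) {x : EuclideanSpace ℝ (Fin n)} (hx : x ≠ 0) {c : ℝ}
    (hc : 0 < c) : ∃ m : ℝ, 0 < m ∧ φ (c⁻¹ • x) = m • φ x ∧
      ∀ u, (inner ℝ x u : ℝ) = -c → m * (inner ℝ (φ x) (ψ u) : ℝ) = -1 := by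
  obtain ⟨m, hm, hmx⟩ := h.exists_map_smul hx (inv_pos.2 hc)
  refine ⟨m, hm, hmx, fun u hu => ?_⟩
  rw [← real_inner_smul_left, ← hmx]
  apply h.inner_eq_neg_one
  rw [real_inner_smul_left, hu, mul_neg, inv_mul_cancel₀ hc.ne']

theorem inner_congr_right (h : IsRep σ φ ψ) {x u u' : EuclideanSpace ℝ (Fin n)} {c : ℝ}
    (hc : 0 < c) (hu : (inner ℝ x u : ℝ) = -c) (hu' : (inner ℝ x u' : ℝ) = -c) :
    (inner ℝ (φ x) (ψ u) : ℝ) = inner ℝ (φ x) (ψ u') := by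
  obtain ⟨m, hm, -, hmu⟩ := h.exists_mul_inner_eq (ne_zero_of_inner_eq_neg hc hu).1 hc
  exact mul_left_cancel₀ hm.ne' ((hmu u hu).trans (hmu u' hu').symm)

theorem inner_congr_left (h : IsRep σ φ ψ) {x x' u : EuclideanSpace ℝ (Fin n)} {c : ℝ}
    (hc : 0 < c) (hu : (inner ℝ x u : ℝ) = -c) (hu' : (inner ℝ x' u : ℝ) = -c) :
    (inner ℝ (φ x) (ψ u) : ℝ) = inner ℝ (φ x') (ψ u) := by
  rw [real_inner_comm, real_inner_comm (ψ u) (φ x')]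
  exact h.conj.inner_congr_right hc (by rwa [real_inner_comm]) (by rwa [real_inner_comm])

/-- For independent `x`, `x'` a common `w` pairing to `-c` with both links the two values; dependent
ones are linked through a third vector independent of both. -/
theorem inner_congr (hn : 2 ≤ n) (h : IsRep σ φ ψ) {x x' u u' : EuclideanSpace ℝ (Fin n)} {c : ℝ}
    (hc : 0 < c) (hu : (inner ℝ x u : ℝ) = -c) (hu' : (inner ℝ x' u' : ℝ) = -c) :
    (inner ℝ (φ x) (ψ u) : ℝ) = inner ℝ (φ x') (ψ u') := by
  have key : ∀ {x x' u u' : EuclideanSpace ℝ (Fin n)}, LinearIndependent ℝ ![x, x'] →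
      (inner ℝ x u : ℝ) = -c → (inner ℝ x' u' : ℝ) = -c →
      (inner ℝ (φ x) (ψ u) : ℝ) = inner ℝ (φ x') (ψ u') := by
    intro x x' u u' hind hu hu'
    obtain ⟨w, hw, hw'⟩ := exists_inner_pair hind (-c) (-c)
    rw [h.inner_congr_right hc hu hw, h.inner_congr_left hc hw hw', h.inner_congr_right hc hw' hu']
  have hx := (ne_zero_of_inner_eq_neg hc hu).1
  have hx' := (ne_zero_of_inner_eq_neg hc hu').1
  by_cases hind : LinearIndependent ℝ ![x, x']
  · exact key hind hu hu'
  · rw [LinearIndependent.pair_iff' hx] at hind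
    push Not at hind
    obtain ⟨a, rfl⟩ := hind
    have ha : a ≠ 0 := fun ha => hx' (by rw [ha, zero_smul])
    obtain ⟨y, hy⟩ := exists_pair hn hx
    obtain ⟨v, hv⟩ := exists_inner (x := y) (hy.ne_zero 1) (-c)
    have hy' : LinearIndependent ℝ ![y, a • x] := by
      rw [LinearIndependent.pair_symm_iff]
      rw [LinearIndependent.pair_iff] at hy ⊢
      intro s t hst
      have := hy (s * a) t (by rw [mul_smul]; exact hst)
      exact ⟨(mul_eq_zero.1 this.1).resolve_right ha, this.2⟩
    exact (key hy hu hv).trans (key hy' hv hu')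

/-- The transformed inner product is a function of the inner product where that is negative. -/
theorem exists_inner_eq_neg (hn : 2 ≤ n) (h : IsRep σ φ ψ) :
    ∃ M : ℝ → ℝ, (∀ c, 0 < c → 0 < M c) ∧ M 1 = 1 ∧ M 2 ≠ 1 ∧
      ∀ c, 0 < c → ∀ x u, (inner ℝ x u : ℝ) = -c → (inner ℝ (φ x) (ψ u) : ℝ) = -M c := by
  obtain ⟨e, he⟩ := @exists_ne (EuclideanSpace ℝ (Fin n))
    (nontrivial_of_finrank_pos (R := ℝ) (by rw [finrank_euclideanSpace_fin]; omega)) 0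
  have hw : ∀ c : ℝ, ∃ w : EuclideanSpace ℝ (Fin n), (inner ℝ e w : ℝ) = -c := fun c =>
    exists_inner he (-c)
  choose w hw using hw
  refine ⟨fun c => -(inner ℝ (φ e) (ψ (w c)) : ℝ), ?_, ?_, ?_, ?_⟩
  · intro c hc
    obtain ⟨m, hm, -, hmu⟩ := h.exists_mul_inner_eq he hc
    have := hmu _ (hw c)
    nlinarith
  · simp only [h.inner_eq_neg_one (hw 1), neg_neg]
  · intro h2
    obtain ⟨m, hm, hmx, hmu⟩ := h.exists_mul_inner_eq he two_pos
    have h3 := hmu _ (hw 2)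
    have hm1 : m = 1 := by rw [neg_eq_iff_eq_neg.1 h2] at h3; linarith
    have he2 : (2 : ℝ)⁻¹ • e ≠ 0 := smul_ne_zero (by norm_num) he
    rw [hm1, one_smul] at hmx
    have h4 : σ (ray ((2 : ℝ)⁻¹ • e)) = σ (ray e) := by
      rw [h.map_ray _ he2, h.map_ray _ he, hmx]
    have h5 := ray_injective he2 he (h.inj h4)
    have h6 : ((2 : ℝ)⁻¹ - 1) • e = 0 := by rw [sub_smul, one_smul, sub_eq_zero]; exact h5
    rcases smul_eq_zero.1 h6 with h6 | h6
    · norm_num at h6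
    · exact he h6
  · intro c hc x u hu
    rw [neg_neg]
    exact h.inner_congr hn hc hu (hw c)

/-- `x + y` lies in `ray x ⊔ ray y`. The image half-space `hs (ψ u)` keeps the join of the image
rays away from the origin, hence within the span of `φ x` and `φ y`. -/
theorem map_add_mem_span (h : IsRep σ φ ψ) {x y : EuclideanSpace ℝ (Fin n)}
    (hxy : LinearIndependent ℝ ![x, y]) : φ (x + y) ∈ Submodule.span ℝ {φ x, φ y} := by
  obtain ⟨u, hxu, hyu⟩ := exists_inner_pair hxy (-1) (-1)
  have hx : x ≠ 0 := hxy.ne_zero 0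
  have hy : y ≠ 0 := hxy.ne_zero 1
  have hsum : x + y ≠ 0 := (ne_zero_of_inner_eq_neg (u := u) two_pos (by
    rw [inner_add_left, hxu, hyu]; norm_num)).1
  have hle : ray (x + y) ≤ ray x ⊔ ray y := by
    have := (ray x ⊔ ray y).comb_mem (ray_le_iff.1 le_sup_left) (ray_le_iff.1 le_sup_right)
      (a := 1) (b := 1) zero_le_one zero_le_one (by norm_num)
    rw [ray_le_iff]
    simpa using this
  have hle' := OrderHomClass.mono σ hle
  rw [map_sup, h.map_ray _ hsum, h.map_ray _ hx, h.map_ray _ hy] at hle'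
  have hslice : ray (φ x) ⊔ ray (φ y) ≤ slice (Submodule.span ℝ {φ x, φ y}) (ψ u) :=
    sup_le (ray_le_iff.2 ⟨Submodule.subset_span (by simp), (h.inner_eq_neg_one hxu).le⟩)
      (ray_le_iff.2 ⟨Submodule.subset_span (by simp), (h.inner_eq_neg_one hyu).le⟩)
  exact (ray_le_iff.1 (hle'.trans hslice)).1

end IsRep

/-! ### The functional equation -/

theorem weights_eq_one {M : ℝ → ℝ} {a b : ℝ} (hpos : ∀ c, 0 < c → 0 < M c) (h1 : M 1 = 1)
    (h2 : M 2 ≠ 1) (hM : ∀ c d, 0 < c → 0 < d → M (c + d) = a * M c + b * M d) :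
    a = 1 ∧ b = 1 := by
  have e2 := hM 1 1 one_pos one_pos
  have e3 := hM 1 2 one_pos two_pos
  have e3' := hM 2 1 two_pos one_pos
  have e4 := hM 2 2 two_pos two_pos
  have e4' := hM 1 3 one_pos three_pos
  have p2 := hpos 2 two_pos
  norm_num [h1] at e2 e3 e3' e4 e4'
  -- Computing `M 3` as `M (1 + 2)` and as `M (2 + 1)` gives `a = b`, whence `M 2 = 2 * a`.
  -- Computing `M 4` as `M (2 + 2)` and as `M (1 + 3)` then gives `a * (2 * a - 1) * (a - 1) = 0`.
  have hab : a = b := by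
    have : (a - b) * (M 2 - 1) = 0 := by linear_combination e3 - e3'
    rcases mul_eq_zero.1 this with h | h
    · linarith
    · exact (h2 (by linarith)).elim
  subst hab
  have ha : a ≠ 0 := by
    rintro rfl
    linarith
  have ha2 : 2 * a - 1 ≠ 0 := fun h => h2 (by linarith)
  have : a * (2 * a - 1) * (a - 1) = 0 := by
    rw [e3, e2] at e4'
    rw [e2] at e4
    linear_combination e4 - e4'
  rcases mul_eq_zero.1 this with h | h
  · exact (mul_ne_zero ha ha2 h).elim
  · constructor <;> linarith

/-- Positivity makes `M` increasing, and it fixes positive integers, so it moves no point by more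
than one. Multiples of `c` would magnify any error at `c`. -/
theorem eq_self_of_add_of_pos {M : ℝ → ℝ} (hpos : ∀ c, 0 < c → 0 < M c) (h1 : M 1 = 1)
    (hM : ∀ c d, 0 < c → 0 < d → M (c + d) = M c + M d) {c : ℝ} (hc : 0 < c) : M c = c := by
  have hmul : ∀ k : ℕ, ∀ d, 0 < d → M ((k + 1) * d) = (k + 1) * M d := by
    intro k d hd
    induction k with
    | zero => simp
    | succ k ih =>
      push_cast
      rw [add_mul _ _ d, one_mul, hM _ _ (by positivity) hd, ih]
      ring
  have hnat : ∀ k : ℕ, M (k + 1) = k + 1 := fun k => by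
    have := hmul k 1 one_pos
    rwa [mul_one, h1, mul_one] at this
  have hmono : ∀ a b, 0 < a → a < b → M a < M b := fun a b ha hab => by
    have := hM a (b - a) ha (by linarith)
    rw [add_sub_cancel] at this
    linarith [hpos (b - a) (by linarith)]
  have hbound : ∀ d, 0 < d → |M d - d| ≤ 1 := by
    intro d hd
    have hfl := Nat.floor_le hd.le
    have hlt := Nat.lt_floor_add_one d
    have hup := (hmono d _ hd hlt).trans_eq (hnat _)
    have hlow : (⌊d⌋₊ : ℝ) ≤ M d := by
      rcases Nat.eq_zero_or_pos ⌊d⌋₊ with h0 | h0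
      · rw [h0]
        exact_mod_cast (hpos d hd).le
      · obtain ⟨k, hk⟩ : ∃ k, ⌊d⌋₊ = k + 1 := ⟨⌊d⌋₊ - 1, by omega⟩
        rw [hk] at hfl ⊢
        push_cast at hfl ⊢
        rcases hfl.eq_or_lt with h | h
        · rw [← h, hnat]
        · have := hmono _ _ (by positivity) h
          rw [hnat] at this
          exact this.le
    rw [abs_le]
    constructor <;> linarith
  by_contra hne
  have hd : 0 < |M c - c| := abs_pos.2 (sub_ne_zero.2 hne)
  obtain ⟨k, hk⟩ := exists_nat_gt (1 / |M c - c|)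
  have h2 := hbound ((k + 1) * c) (by positivity)
  rw [hmul k c hc, ← mul_sub, abs_mul, abs_of_pos (by positivity : (0 : ℝ) < k + 1)] at h2
  rw [div_lt_iff₀ hd] at hk
  nlinarith

/-! ### Linearity of the map on rays -/

namespace IsRep

variable {σ : LatticeHom (PC n) (PC n)} {φ ψ : EuclideanSpace ℝ (Fin n) → EuclideanSpace ℝ (Fin n)}

/-- Pairing `φ (x + y) = a • φ x + b • φ y` with `ψ u` gives `M (c + d) = a * M c + b * M d`;
independence lets `u` realize any `c` and `d`. -/
theorem map_add_and_inner_eq (hn : 2 ≤ n) (h : IsRep σ φ ψ) :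
    (∀ x y, LinearIndependent ℝ ![x, y] → φ (x + y) = φ x + φ y) ∧
      ∀ x u, (inner ℝ x u : ℝ) < 0 → (inner ℝ (φ x) (ψ u) : ℝ) = inner ℝ x u := by
  obtain ⟨M, hpos, h1, h2, hM⟩ := h.exists_inner_eq_neg hn
  have hadd : ∀ x y, LinearIndependent ℝ ![x, y] → φ (x + y) = φ x + φ y ∧
      ∀ c d, 0 < c → 0 < d → M (c + d) = M c + M d := by
    intro x y hxy
    obtain ⟨a, b, hab⟩ := Submodule.mem_span_pair.1 (h.map_add_mem_span hxy)
    have hMab : ∀ c d, 0 < c → 0 < d → M (c + d) = a * M c + b * M d := by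
      intro c d hc hd
      obtain ⟨u, hxu, hyu⟩ := exists_inner_pair hxy (-c) (-d)
      have h3 := hM (c + d) (by linarith) (x + y) u (by rw [inner_add_left, hxu, hyu]; ring)
      rw [← hab, inner_add_left, real_inner_smul_left, real_inner_smul_left, hM c hc x u hxu,
        hM d hd y u hyu] at h3
      linarith
    obtain ⟨rfl, rfl⟩ := weights_eq_one hpos h1 h2 hMab
    exact ⟨by rw [← hab, one_smul, one_smul], fun c d hc hd => by simpa using hMab c d hc hd⟩
  refine ⟨fun x y hxy => (hadd x y hxy).1, fun x u hxu => ?_⟩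
  have hx : x ≠ 0 := (ne_zero_of_inner_eq_neg (c := -(inner ℝ x u : ℝ)) (u := u) (by linarith)
    (by rw [neg_neg])).1
  obtain ⟨y, hxy⟩ := exists_pair hn hx
  rw [hM (-(inner ℝ x u : ℝ)) (by linarith) x u (by rw [neg_neg]),
    eq_self_of_add_of_pos hpos h1 (hadd x y hxy).2 (by linarith), neg_neg]

theorem map_smul_of_pos (hn : 2 ≤ n) (h : IsRep σ φ ψ) {x : EuclideanSpace ℝ (Fin n)} (hx : x ≠ 0)
    {c : ℝ} (hc : 0 < c) : φ (c • x) = c • φ x := by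
  obtain ⟨m, hm, hmx⟩ := h.exists_map_smul hx hc
  obtain ⟨u, hu⟩ := exists_inner hx (-1)
  have hinner := (h.map_add_and_inner_eq hn).2
  have h1 : (inner ℝ (c • x) u : ℝ) = -c := by rw [real_inner_smul_left, hu]; ring
  have h2 := hinner (c • x) u (by linarith)
  rw [hmx, real_inner_smul_left, hinner x u (by linarith), h1, hu] at h2
  rw [hmx, show m = c by linarith]

theorem map_neg (hn : 2 ≤ n) (h : IsRep σ φ ψ) {x : EuclideanSpace ℝ (Fin n)} (hx : x ≠ 0) :
    φ (-x) = -φ x := by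
  obtain ⟨y, hxy⟩ := exists_pair hn hx
  have hadd := (h.map_add_and_inner_eq hn).1
  -- Additivity is known for independent pairs only, so it is applied to `y = (x + y) + (-x)`
  -- instead of `x + (-x)`.
  have hxy' : LinearIndependent ℝ ![x + y, -x] := by
    rw [LinearIndependent.pair_iff] at hxy ⊢
    intro s t hst
    have := hxy (s - t) s (by rw [← hst]; module)
    exact ⟨this.2, by linarith [this.1, this.2]⟩
  have h1 := hadd _ _ hxy'
  rw [hadd _ _ hxy, show x + y + -x = y by abel] at h1
  rw [eq_neg_iff_add_eq_zero]
  have h2 : φ (-x) + φ x + φ y = 0 + φ y := by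
    rw [zero_add]
    conv_rhs => rw [h1]
    abel
  exact add_right_cancel h2

/-- The map of the rays is the restriction of a linear isomorphism. -/
theorem exists_linearEquiv (hn : 2 ≤ n) (h : IsRep σ φ ψ) :
    ∃ g : EuclideanSpace ℝ (Fin n) ≃ₗ[ℝ] EuclideanSpace ℝ (Fin n), ∀ x, x ≠ 0 → g x = φ x := by
  classical
  -- `φ 0` is unconstrained, so the value at the origin is reset.
  set f : EuclideanSpace ℝ (Fin n) → EuclideanSpace ℝ (Fin n) := fun x => if x = 0 then 0 else φ x
    with hf
  have hf0 : f 0 = 0 := if_pos rfl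
  have hf1 : ∀ x, x ≠ 0 → f x = φ x := fun x hx => if_neg hx
  have hsmul : ∀ (c : ℝ) x, f (c • x) = c • f x := by
    intro c x
    by_cases hx : x = 0
    · rw [hx, smul_zero, hf0, smul_zero]
    rcases lt_trichotomy c 0 with hc | rfl | hc
    · rw [hf1 _ (smul_ne_zero hc.ne hx), hf1 x hx, ← neg_neg c, neg_smul (-c) x, neg_smul (-c),
        h.map_neg hn (smul_ne_zero (by linarith) hx), h.map_smul_of_pos hn hx (by linarith)]
    · rw [zero_smul, zero_smul, hf0]
    · rw [hf1 _ (smul_ne_zero hc.ne' hx), hf1 x hx, h.map_smul_of_pos hn hx hc]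
  have hadd : ∀ x y, f (x + y) = f x + f y := by
    intro x y
    by_cases hx : x = 0
    · rw [hx, hf0, zero_add, zero_add]
    by_cases hxy : LinearIndependent ℝ ![x, y]
    · have hsum : x + y ≠ 0 := by
        intro h0
        have := LinearIndependent.pair_iff.1 hxy 1 1 (by simpa using h0)
        exact one_ne_zero this.1
      rw [hf1 _ hsum, hf1 x hx, hf1 y (hxy.ne_zero 1), (h.map_add_and_inner_eq hn).1 x y hxy]
    · rw [LinearIndependent.pair_iff' hx] at hxy
      push Not at hxy
      obtain ⟨a, rfl⟩ := hxy
      have : x + a • x = (1 + a) • x := by rw [add_smul, one_smul]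
      rw [this, hsmul, hsmul, add_smul, one_smul]
  let g : EuclideanSpace ℝ (Fin n) →ₗ[ℝ] EuclideanSpace ℝ (Fin n) :=
    { toFun := f
      map_add' := hadd
      map_smul' := hsmul }
  have hg : Function.Injective g := by
    rw [injective_iff_map_eq_zero]
    intro x hx
    by_contra hx0
    exact h.ne_zero x hx0 ((hf1 x hx0).symm.trans hx)
  exact ⟨LinearEquiv.ofInjectiveEndo g hg, fun x hx => hf1 x hx⟩

end IsRep

/-! ### Classification -/

/-- Every injective endomorphism of `PC n` is induced by a linear isomorphism. -/
theorem exists_linearEquiv_of_injective (hn : 2 ≤ n) {σ : LatticeHom (PC n) (PC n)}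
    (hσ : Function.Injective σ) :
    ∃ g : EuclideanSpace ℝ (Fin n) ≃ₗ[ℝ] EuclideanSpace ℝ (Fin n),
      ∀ K : PC n, (σ K).carrier = g '' K.carrier := by
  obtain ⟨φ, ψ, h⟩ := exists_isRep hn hσ
  obtain ⟨g, hg⟩ := h.exists_linearEquiv hn
  have hneg : ∀ x u, (inner ℝ x u : ℝ) < 0 → (inner ℝ (g x) (ψ u) : ℝ) = inner ℝ x u := by
    intro x u hxu
    have hx : x ≠ 0 := (ne_zero_of_inner_eq_neg (c := -(inner ℝ x u : ℝ)) (u := u) (by linarith)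
      (by rw [neg_neg])).1
    rw [hg x hx, (h.map_add_and_inner_eq hn).2 x u hxu]
  -- Subtracting a large multiple of `u` from `x` makes the pairing negative; linearity of `g`
  -- removes the restriction.
  have hinner : ∀ x u, u ≠ 0 → (inner ℝ (g x) (ψ u) : ℝ) = inner ℝ x u := by
    intro x u hu
    have hpos : 0 < (inner ℝ u u : ℝ) := real_inner_self_pos.2 hu
    set s : ℝ := (|inner ℝ x u| + 1) / inner ℝ u u
    have hs : s * inner ℝ u u = |inner ℝ x u| + 1 := div_mul_cancel₀ _ hpos.ne'
    have h1 := hneg (x - s • u) u (by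
      rw [inner_sub_left, real_inner_smul_left, hs]
      linarith [le_abs_self (inner ℝ x u : ℝ)])
    have h2 := hneg (-u) u (by rw [inner_neg_left]; linarith)
    rw [_root_.map_neg, inner_neg_left, inner_neg_left] at h2
    rw [_root_.map_sub, map_smul, inner_sub_left, inner_sub_left, real_inner_smul_left,
      real_inner_smul_left] at h1
    have h3 : (inner ℝ (g u) (ψ u) : ℝ) = inner ℝ u u := by linarith
    rw [h3] at h1
    linarith
  have hbot : σ ⊥ = ⊥ := map_bot_eq hn hσ
  have htop : σ ⊤ = ⊤ := by
    have h1 := map_bot_eq hn (conj_injective hσ)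
    rw [conj_apply, dual_bot] at h1
    rw [← dual_dual (σ ⊤), h1, dual_bot]
  refine ⟨g, fun K => Set.Subset.antisymm ?_ ?_⟩
  · intro p hp
    obtain ⟨q, rfl⟩ := g.surjective p
    refine ⟨q, ?_, rfl⟩
    have hK : K ≠ ⊥ := by
      rintro rfl
      rw [hbot] at hp
      exact hp.elim
    -- A half-space `hs u` containing `K` but not `q` goes to `hs (ψ u)`, which contains `σ K` but
    -- not `g q`.
    by_contra hq
    obtain ⟨u, hu, huq⟩ := exists_mem_dual_of_notMem hq
    have hu0 : u ≠ 0 := by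
      rintro rfl
      obtain ⟨k, hk⟩ := nonempty_of_ne_bot hK
      have := hu k hk
      rw [inner_zero_left] at this
      linarith
    have hle := OrderHomClass.mono σ (le_hs_iff.2 hu)
    rw [h.map_hs u hu0] at hle
    have h1 := mem_hs.1 (hle hp)
    rw [hinner q u hu0, real_inner_comm] at h1
    linarith
  · rintro _ ⟨x, hx, rfl⟩
    by_cases hx0 : x = 0
    · subst hx0
      rw [eq_top_iff_zero_mem.2 hx, htop]
      exact Set.mem_univ _
    · rw [hg x hx0, ← ray_le_iff, ← h.map_ray x hx0]
      exact OrderHomClass.mono σ (ray_le_iff.2 hx)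

/-- The order isomorphism between image sets under a linear isomorphism. -/
theorem exists_orderIso (g : EuclideanSpace ℝ (Fin n) ≃ₗ[ℝ] EuclideanSpace ℝ (Fin n)) :
    ∃ e : PC n ≃o PC n, ∀ K, (e K).carrier = g '' K.carrier := by
  have hmem : ∀ (g : EuclideanSpace ℝ (Fin n) ≃ₗ[ℝ] EuclideanSpace ℝ (Fin n)) (K : PC n),
      (IsClosed (g '' K.carrier) ∧ IsPseudoCone (g '' K.carrier)) ∨
        g '' K.carrier = ∅ ∨ g '' K.carrier = Set.univ := by
    intro g K
    by_cases h0 : (0 : EuclideanSpace ℝ (Fin n)) ∈ K.carrier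
    · right; right
      rw [K.eq_univ_of_zero_mem h0, Set.image_univ, g.surjective.range_eq]
    · refine mem_PC_of ?_ (K.convex.linear_image g.toLinearMap) ?_ ?_
      · exact g.toContinuousLinearEquiv.toHomeomorph.isClosedMap _ K.isClosed
      · rintro ⟨x, hx, hx0⟩
        exact h0 (g.map_eq_zero_iff.1 hx0 ▸ hx)
      · rintro _ ⟨x, hx, rfl⟩ c hc
        exact ⟨c • x, K.smul_mem x hx c hc, map_smul g c x⟩
  refine ⟨⟨⟨fun K => ⟨_, hmem g K⟩, fun K => ⟨_, hmem g.symm K⟩, ?_, ?_⟩, ?_⟩, fun _ => rfl⟩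
  · intro K
    ext x
    simp
  · intro K
    ext x
    simp
  · intro K L
    exact Set.image_subset_image_iff g.injective

end PC

theorem mainTheorem2 (n : ℕ) (hn : 2 ≤ n) (τ : PC n → PC n) :
    ((∀ K L : PC n, τ (K ⊓ L) = τ K ⊔ τ L) ∧ (∀ K L : PC n, τ (K ⊔ L) = τ K ⊓ τ L)) ↔
      ((∃ C : PC n, ∀ K : PC n, τ K = C) ∨
        (∃ g : EuclideanSpace ℝ (Fin n) ≃ₗ[ℝ] EuclideanSpace ℝ (Fin n),
          ∀ K : PC n, (τ K).carrier = g '' dualSet K.carrier)) := by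
  constructor
  · rintro ⟨hinf, hsup⟩
    let σ : LatticeHom (PC n) (PC n) :=
      { toFun := fun K => τ K.dual
        map_sup' := fun K L => by rw [PC.dual_sup, hinf]
        map_inf' := fun K L => by rw [PC.dual_inf, hsup] }
    have hτ : ∀ K, τ K = σ K.dual := fun K => congrArg τ (PC.dual_dual K).symm
    rcases PC.injective_or_constant hn σ with hσ | hσ
    · obtain ⟨g, hg⟩ := PC.exists_linearEquiv_of_injective hn hσ
      exact Or.inr ⟨g, fun K => by rw [hτ, hg]; rfl⟩
    · exact Or.inl ⟨σ ⊥, fun K => by rw [hτ, hσ]⟩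
  · rintro (⟨C, hC⟩ | ⟨g, hg⟩)
    · simp [hC]
    · obtain ⟨e, he⟩ := PC.exists_orderIso g
      have hτ : ∀ K, τ K = e K.dual := fun K => PC.ext (by rw [hg, he]; rfl)
      refine ⟨fun K L => ?_, fun K L => ?_⟩
      · rw [hτ, hτ, hτ, PC.dual_inf, map_sup]
      · rw [hτ, hτ, hτ, PC.dual_sup, map_inf]
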